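/- Let $X$ be a compact metrizable space, $\mu_0$ a Borel probability measure on $X$, and let $\mathcal P(X)$ be the space of Borel probability measures on $X$ with the weak topology. Let $m\ge 1$, let $W:X^m\to\,]-\infty,\infty]$ be symmetric and lower semicontinuous, and for $N\geq 1$ let $$H^{(N)}(x_1,\dots,x_N)=\frac1{N^{m-1}}\sum_{I}W(x_{i_1},\dots,x_{i_m}),$$ where $I=(i_1,\dots,i_m)$ runs over all multi-indices in $\{1,\dots,N\}^m$ with pairwise distinct entries. Let $(\beta_N)_{N\ge1}$ be positive real numbers and assume that $0<Z_N<\infty$ for all $N$, where $Z_N:=\int_{X^N}e^{-\beta_NH^{(N)}}d\mu_0^{\otimes N}$, so that the Gibbs measures $\mu^{(N)}_{\beta_N}=Z_N^{-1}e^{-\beta_NH^{(N)}}\mu_0^{\otimes N}$ are well-defined probability measures on $X^N$. Let $\delta_N(x_1,\dots,x_N)=\frac1N\sum_{i=1}^N\delta_{x_i}\in\mathcal P(X)$ be the empirical measure, and set $$E(\mu)=\int_{X^m}W\,d\mu^{\otimes m},\qquad F_\beta(\mu)=E(\mu)+\frac1\beta D(\mu)\quad(0<\beta<\infty),\qquad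 F_\infty=E,$$ where $D(\mu)=\int_X\log\frac{d\mu}{d\mu_0}\,d\mu$ if $\mu\ll\mu_0$, and $D(\mu)=\infty$ otherwise. A sequence $\Gamma_N$ of Borel measures on $\mathcal P(X)$ is said to satisfy the large deviation principle (LDP) with speed $r_N$ and rate functional $I$ if $I:\mathcal P(X)\to\,]-\infty,\infty]$ is lower semicontinuous, $\limsup_{N}\frac1{r_N}\log\Gamma_N(\mathcal F)\le-\inf_{\mathcal F}I$ for every closed $\mathcal F\subset\mathcal P(X)$, and $\liminf_{N}\frac1{r_N}\log\Gamma_N(\mathcal G)\ge-\inf_{\mathcal G}I$ for every open $\mathcal G\subset\mathcal P(X)$. (1) Suppose that $\beta_N\to\beta\in\,]0,\infty[$. Then the non-normalized measures $(\delta_N)_*\big(e^{-\beta_NH^{(N)}}\mu_0^{\otimes N}\big)$ satisfy the LDP with speed $\beta_NN$ and rate functional $F_\beta$. If moreover $F_\beta$ is not identically $+\infty$ (for instance, if $E(\mu_0)<\infty$), then the laws $(\delta_N)_*\mu^{(N)}_{\beta_N}$ of the empirical measures satisfy the LDP with speed $\beta_NN$ and rate functional $F_\beta-\inf_{\mathcal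 P(X)}F_\beta$. (2) Suppose that $\beta_N\to\infty$ and that the following approximation property holds: for every $\mu\in\mathcal P(X)$ with $E(\mu)<\infty$ there are $\mu_j\in\mathcal P(X)$, absolutely continuous with respect to $\mu_0$, with $\mu_j\to\mu$ weakly and $E(\mu_j)\to E(\mu)$. Then the same two conclusions hold with $\beta=\infty$, that is, with $F_\infty=E$ in place of $F_\beta$. -/

import Mathlib

open MeasureTheory Filter Topology TopologicalSpace
open scoped ENNReal

noncomputable section

namespace MeanFieldGibbs

/-- Large deviation principle on a topological space `Y`, for a sequence `Γ N`, `N = 1, 2, …`, of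
(not necessarily normalized) Borel measures, with speed `r N` and rate function
`I : Y → ]-∞, ∞]`. Being a rate function (lower semicontinuous, never `-∞`) is part of the notion.
Logarithms are extended: `ENNReal.log 0 = -∞`, and infima over the empty set are `+∞`. -/
structure SatisfiesLDP {Y : Type*} [TopologicalSpace Y] (Γ : ℕ+ → @Measure Y (borel Y))
    (r : ℕ+ → ℝ) (I : Y → EReal) : Prop where
  ne_bot : ∀ y, I y ≠ ⊥
  lowerSemicontinuous : LowerSemicontinuous I
  upper_bound : ∀ F : Set Y, IsClosed F →
    limsup (fun N => ((1 / r N : ℝ) : EReal) * ENNReal.log (Γ N F)) atTop ≤ -(⨅ y ∈ F, I y)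
  lower_bound : ∀ G : Set Y, IsOpen G →
    -(⨅ y ∈ G, I y) ≤ liminf (fun N => ((1 / r N : ℝ) : EReal) * ENNReal.log (Γ N G)) atTop

/-- The integral of an extended-real function, `∫ f⁺ - ∫ f⁻`. (It is used for functions which are
bounded from below and probability measures, so that the second term is finite.) -/
def eintegral {Z : Type*} [MeasurableSpace Z] (ν : Measure Z) (f : Z → EReal) : EReal :=
  ((∫⁻ z, (f z).toENNReal ∂ν : ℝ≥0∞) : EReal) - ((∫⁻ z, (-f z).toENNReal ∂ν : ℝ≥0∞) : EReal)

variable {X : Type*}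

/-- The mean field Hamiltonian of an `m`-point interaction `W`: `N^{-(m-1)}` times the sum of
`W(x_{i₁}, …, x_{iₘ})` over all (ordered) multi-indices with pairwise distinct entries. -/
def hamiltonian {m : ℕ} (W : (Fin m → X) → EReal) (N : ℕ) (x : Fin N → X) : EReal :=
  ((1 / (N : ℝ) ^ (m - 1) : ℝ) : EReal) * ∑ I : Fin m ↪ Fin N, W (fun k => x (I k))

/-- The empirical measure `δ_N(x) = (1/N) ∑ᵢ δ_{xᵢ}`. -/
def empiricalMeasure [MeasurableSpace X] (N : ℕ+) (x : Fin N → X) : ProbabilityMeasure X :=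
  ⟨(N : ℝ≥0∞)⁻¹ • ∑ i, Measure.dirac (x i), ⟨by
    have h : (N : ℝ≥0∞) ≠ 0 := by exact_mod_cast N.pos.ne'
    simp [ENNReal.inv_mul_cancel h (ENNReal.natCast_ne_top N)]⟩⟩

section
variable [MeasurableSpace X]

/-- The non-normalized Gibbs measure `e^{-b H^{(N)}} μ₀^{⊗N}` on `X^N`. -/
def gibbsWeight (μ₀ : Measure X) {m : ℕ} (W : (Fin m → X) → EReal) (b : ℝ) (N : ℕ) :
    Measure (Fin N → X) :=
  (Measure.pi fun _ : Fin N => μ₀).withDensity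
    fun x => EReal.exp (-((b : EReal) * hamiltonian W N x))

/-- The partition function `Z_{N,b} = ∫ e^{-b H^{(N)}} dμ₀^{⊗N}`. -/
def partitionFunction (μ₀ : Measure X) {m : ℕ} (W : (Fin m → X) → EReal) (b : ℝ) (N : ℕ) :
    ℝ≥0∞ :=
  ∫⁻ x, EReal.exp (-((b : EReal) * hamiltonian W N x)) ∂(Measure.pi fun _ : Fin N => μ₀)

/-- The Gibbs measure `e^{-b H^{(N)}} μ₀^{⊗N} / Z_{N,b}` on `X^N`. -/
def gibbsMeasure (μ₀ : Measure X) {m : ℕ} (W : (Fin m → X) → EReal) (b : ℝ) (N : ℕ) :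
    Measure (Fin N → X) :=
  (partitionFunction μ₀ W b N)⁻¹ • gibbsWeight μ₀ W b N

variable [TopologicalSpace X] [OpensMeasurableSpace X]

/-- The law `(δ_N)_* ν` of the empirical measure, as a measure on the Borel σ-algebra of the
space of probability measures with the weak topology. -/
def empiricalLaw (N : ℕ+) (ν : Measure (Fin N → X)) :
    @Measure (ProbabilityMeasure X) (borel (ProbabilityMeasure X)) :=
  @Measure.map _ _ _ (borel (ProbabilityMeasure X)) (empiricalMeasure N) ν

end

section
variable [MeasurableSpace X]

/-- The macroscopic energy `E(μ) = ∫ W dμ^{⊗m}`. -/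
def energy {m : ℕ} (W : (Fin m → X) → EReal) (μ : ProbabilityMeasure X) : EReal :=
  eintegral (Measure.pi fun _ : Fin m => (μ : Measure X)) W

/-- The free energy `F_b(μ) = E(μ) + (1/b) D(μ, μ₀)`, where `D` is the relative entropy. -/
def freeEnergy (μ₀ : Measure X) {m : ℕ} (W : (Fin m → X) → EReal) (b : ℝ)
    (μ : ProbabilityMeasure X) : EReal :=
  energy W μ + ((1 / b : ℝ) : EReal) * (InformationTheory.klDiv (μ : Measure X) μ₀ : EReal)

/-- The approximation property: every `μ` of finite energy is a weak limit of a sequence of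
probability measures, absolutely continuous with respect to `μ₀`, along which the energies
converge to that of `μ`. -/
def ApproximationProperty [TopologicalSpace X] [OpensMeasurableSpace X] (μ₀ : Measure X)
    (E : ProbabilityMeasure X → EReal) : Prop :=
  ∀ μ : ProbabilityMeasure X, E μ < ⊤ →
    ∃ ν : ℕ → ProbabilityMeasure X,
      (∀ j, (ν j : Measure X) ≪ μ₀) ∧
      Tendsto ν atTop (𝓝 μ) ∧ Tendsto (fun j => E (ν j)) atTop (𝓝 (E μ))

end

end MeanFieldGibbs

end

/-! Both regimes are treated at once through the limiting temperature t = lim 1/β_N ≥ 0 and the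
functional E + tD; for t = 0 the convention 0 · ∞ = 0 makes this E. Since 𝒫(X) is compact, it is
enough to have exponential bounds near each point (`satisfiesLDP_of_local`). Sanov's theorem is not
invoked; its two halves are reproved together with the energy.

Upper bound (`exists_nhds_empiricalLaw_gibbsWeight_le`). If a < E(μ) + tD(μ), split a < e + td with
e < E(μ) and d < D(μ). Lower semicontinuity of W gives a continuous g ≤ W with ∫ g dμ^{⊗m} > e, and
the duality D(μ) = sup_f (∫ f dμ - ∫ (e^f - 1) dμ₀) gives a continuous f witnessing d. Both
conditions define a weak neighbourhood U of μ. When δ_N lies in U, the Hamiltonian is at least N(e -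
o(1)), because the diagonals are a vanishing fraction of all multi-indices, while Chernoff's bound
with f gives the event probability at most e^{-Nd} under μ₀^{⊗N}. On U the functional also stays
above a, which is its lower semicontinuity.

Lower bound (`eventually_le_empiricalLaw_gibbsWeight`). At ν of finite energy and entropy, compare
with ν^{⊗N}. Under it δ_N is close to ν with probability tending to 1, and the shifted β_N H plus
the positive part of the log-likelihood has mean at most the expected amount. Markov's inequality
keeps this sum near its mean with probability bounded away from 0. A constant probability suffices,
since constants are invisible at speed β_N N → ∞. For t > 0, finite free energy forces finite
entropy. For t = 0, the approximation property supplies absolutely continuous measures, and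
conditioning on {dν/dμ₀ ≤ k} makes their entropy finite (`exists_klDiv_ne_top_energy_lt`).

Normalization only subtracts the infimum, because the bounds on the whole space determine the growth
of Z_N. -/

namespace MeanFieldGibbs

/-! ### Large deviation principles on a compact space -/

section LDP

variable {Y : Type*} [TopologicalSpace Y]

lemma one_div_mul_log_ofReal_exp {r : ℝ} (hr : 0 < r) (a : ℝ) :
    ((1 / r : ℝ) : EReal) * ENNReal.log (ENNReal.ofReal (Real.exp (-(r * a)))) =
      ((-a : ℝ) : EReal) := by
  rw [ENNReal.log_ofReal_of_pos (Real.exp_pos _), Real.log_exp, ← EReal.coe_mul]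
  congr 1
  field_simp

lemma one_div_mul_log_mono {r : ℝ} (hr : 0 < r) {x y : ℝ≥0∞} (h : x ≤ y) :
    ((1 / r : ℝ) : EReal) * ENNReal.log x ≤ ((1 / r : ℝ) : EReal) * ENNReal.log y :=
  mul_le_mul_of_nonneg_left (ENNReal.log_le_log h) (by exact_mod_cast (one_div_pos.2 hr).le)

/-- Constants are negligible on an exponential scale. -/
lemma eventually_const_mul_exp_le {ι : Type*} {l : Filter ι} {r : ι → ℝ} (hr : Tendsto r l atTop)
    {a b : ℝ} (hab : a < b) (c : ℝ) :
    ∀ᶠ i in l, c * Real.exp (-(r i * b)) ≤ Real.exp (-(r i * a)) := by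
  have h : Tendsto (fun i => Real.exp (r i * (b - a))) l atTop :=
    Real.tendsto_exp_atTop.comp (hr.atTop_mul_const (sub_pos.2 hab))
  filter_upwards [h.eventually_ge_atTop c] with i hi
  calc c * Real.exp (-(r i * b)) ≤ Real.exp (r i * (b - a)) * Real.exp (-(r i * b)) := by gcongr
    _ = Real.exp (-(r i * a)) := by rw [← Real.exp_add]; congr 1; ring

/-- On a compact space, an LDP follows from exponential bounds near each point. -/
theorem satisfiesLDP_of_local [CompactSpace Y] {Γ : ℕ+ → @Measure Y (borel Y)} {r : ℕ+ → ℝ}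
    {I : Y → EReal} (hr : ∀ N, 0 < r N) (hr' : Tendsto r atTop atTop)
    (hbot : ∀ y, I y ≠ ⊥) (hlsc : LowerSemicontinuous I)
    (hup : ∀ (y : Y) (a : ℝ), (a : EReal) < I y →
      ∃ U ∈ 𝓝 y, ∀ᶠ N in atTop, Γ N U ≤ ENNReal.ofReal (Real.exp (-(r N * a))))
    (hlow : ∀ G : Set Y, IsOpen G → ∀ y ∈ G, ∀ a : ℝ, I y < (a : EReal) →
      ∀ᶠ N in atTop, ENNReal.ofReal (Real.exp (-(r N * a))) ≤ Γ N G) :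
    SatisfiesLDP Γ r I := by
  refine ⟨hbot, hlsc, fun F hF => ?_, fun G hG => ?_⟩
  · rw [EReal.le_neg]
    refine EReal.ge_of_forall_gt_iff_ge.1 fun a ha => ?_
    -- The gap between a and b will absorb the number of sets in a finite cover of `F`.
    obtain ⟨b, hab, hb⟩ := EReal.lt_iff_exists_real_btwn.1 ha
    have key : ∃ n : ℕ, ∀ᶠ N in atTop,
        Γ N F ≤ n * ENNReal.ofReal (Real.exp (-(r N * b))) := by
      refine hF.isCompact.induction_on
        (p := fun S => ∃ n : ℕ, ∀ᶠ N in atTop,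
          Γ N S ≤ n * ENNReal.ofReal (Real.exp (-(r N * b)))) ⟨0, by simp⟩ ?_ ?_ ?_
      · rintro S T hST ⟨n, hn⟩
        exact ⟨n, hn.mono fun N h => (measure_mono hST).trans h⟩
      · rintro S T ⟨n, hn⟩ ⟨k, hk⟩
        refine ⟨n + k, ?_⟩
        filter_upwards [hn, hk] with N h1 h2
        refine (measure_union_le S T).trans ((add_le_add h1 h2).trans (le_of_eq ?_))
        push_cast
        ring
      · intro y hy
        obtain ⟨U, hU, h⟩ := hup y b (hb.trans_le (iInf₂_le y hy))
        exact ⟨U, mem_nhdsWithin_of_mem_nhds hU, 1, by simpa using h⟩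
    obtain ⟨n, hn⟩ := key
    rw [EReal.le_neg]
    refine limsup_le_of_le (by isBoundedDefault) ?_
    filter_upwards [hn, eventually_const_mul_exp_le hr' (EReal.coe_lt_coe_iff.1 hab) n]
      with N h1 h2
    have h3 : Γ N F ≤ ENNReal.ofReal (Real.exp (-(r N * a))) := by
      refine h1.trans ?_
      rw [← ENNReal.ofReal_natCast, ← ENNReal.ofReal_mul (by positivity)]
      exact ENNReal.ofReal_le_ofReal h2
    refine (one_div_mul_log_mono (hr N) h3).trans ?_
    rw [one_div_mul_log_ofReal_exp (hr N), EReal.coe_neg]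
  · rw [EReal.neg_le]
    refine le_iInf₂ fun y hy => ?_
    refine EReal.le_of_forall_lt_iff_le.1 fun a ha => ?_
    rw [EReal.neg_le]
    refine le_liminf_of_le (by isBoundedDefault) ?_
    filter_upwards [hlow G hG y hy a ha] with N h
    refine le_trans ?_ (one_div_mul_log_mono (hr N) h)
    rw [one_div_mul_log_ofReal_exp (hr N), EReal.coe_neg]

lemma iInf₂_sub_coe {Z : Type*} (S : Set Z) (I : Z → EReal) (c : ℝ) :
    ⨅ y ∈ S, (I y - c) = (⨅ y ∈ S, I y) - c := by
  have key : ∀ x y : EReal, x ≤ y - c ↔ x + c ≤ y := fun x y =>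
    EReal.le_sub_iff_add_le (Or.inl (EReal.coe_ne_bot c)) (Or.inl (EReal.coe_ne_top c))
  refine le_antisymm ?_ ?_
  · rw [key]
    exact le_iInf₂ fun y hy => (key _ _).1 (iInf₂_le y hy)
  · refine le_iInf₂ fun y hy => ?_
    rw [sub_eq_add_neg, sub_eq_add_neg]
    gcongr
    exact iInf₂_le y hy

/-- Normalizing the measures of an LDP shifts the rate function by its infimum. -/
theorem SatisfiesLDP.normalize {Γ : ℕ+ → @Measure Y (borel Y)} {r : ℕ+ → ℝ} {I : Y → EReal}
    (h : SatisfiesLDP Γ r I) {Z : ℕ+ → ℝ≥0∞} (hZ : ∀ N, Γ N Set.univ = Z N)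
    (hr : ∀ N, 0 < r N) (hbot : (⨅ y, I y) ≠ ⊥) (htop : (⨅ y, I y) ≠ ⊤) :
    SatisfiesLDP (fun N => (Z N)⁻¹ • Γ N) r (fun y => I y - ⨅ z, I z) := by
  lift (⨅ y, I y) to ℝ using ⟨htop, hbot⟩ with c hc
  -- The whole space is both open and closed, so the two bounds pinch the total mass.
  have hu : Tendsto (fun N => ((1 / r N : ℝ) : EReal) * ENNReal.log (Z N)) atTop
      (𝓝 ((-c : ℝ) : EReal)) := by
    refine tendsto_of_le_liminf_of_limsup_le ?_ ?_
    · have := h.lower_bound Set.univ isOpen_univ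
      simpa [hZ, ← hc] using this
    · have := h.upper_bound Set.univ isClosed_univ
      simpa [hZ, ← hc] using this
  have hv : Tendsto (fun N => ((1 / r N : ℝ) : EReal) * ENNReal.log (Z N)⁻¹) atTop
      (𝓝 (c : EReal)) := by
    have := hu.neg
    rw [← EReal.coe_neg, neg_neg] at this
    refine this.congr fun N => ?_
    rw [ENNReal.log_inv, mul_neg]
  have hsplit : ∀ N (S : Set Y),
      ((1 / r N : ℝ) : EReal) * ENNReal.log (((Z N)⁻¹ • Γ N) S) =
      ((1 / r N : ℝ) : EReal) * ENNReal.log (Z N)⁻¹ +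
        ((1 / r N : ℝ) : EReal) * ENNReal.log (Γ N S) := fun N S => by
    rw [Measure.smul_apply, smul_eq_mul, ENNReal.log_mul_add]
    refine EReal.left_distrib_of_nonneg_of_ne_top ?_ (EReal.coe_ne_top _) _ _
    exact_mod_cast (one_div_pos.2 (hr N)).le
  have hcont : ∀ y, ContinuousAt (fun p : EReal × EReal => p.1 + p.2) (I y, ((-c : ℝ) : EReal)) :=
    fun y => EReal.continuousAt_add (Or.inr (EReal.coe_ne_bot _)) (Or.inr (EReal.coe_ne_top _))
  refine ⟨fun y => ?_, ?_, fun F hF => ?_, fun G hG => ?_⟩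
  · rw [sub_eq_add_neg, ← EReal.coe_neg]
    exact fun hy => (EReal.add_eq_bot_iff.1 hy).elim (h.ne_bot y) (EReal.coe_ne_bot _)
  · simp_rw [sub_eq_add_neg, ← EReal.coe_neg]
    exact h.lowerSemicontinuous.add' lowerSemicontinuous_const hcont
  · rw [iInf₂_sub_coe, EReal.neg_sub (Or.inr (EReal.coe_ne_bot _)) (Or.inr (EReal.coe_ne_top _)),
      add_comm]
    simp_rw [hsplit]
    refine (EReal.limsup_add_le ?_ ?_).trans ?_
    · exact Or.inl (by rw [hv.limsup_eq]; exact EReal.coe_ne_bot _)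
    · exact Or.inl (by rw [hv.limsup_eq]; exact EReal.coe_ne_top _)
    · rw [hv.limsup_eq]
      gcongr
      exact h.upper_bound F hF
  · rw [iInf₂_sub_coe, EReal.neg_sub (Or.inr (EReal.coe_ne_bot _)) (Or.inr (EReal.coe_ne_top _)),
      add_comm]
    simp_rw [hsplit]
    refine le_trans ?_ EReal.le_liminf_add
    rw [hv.liminf_eq]
    gcongr
    exact h.lower_bound G hG

end LDP
end MeanFieldGibbs

namespace MeanFieldGibbs

/-! ### Relative entropy as a supremum over test functions -/

section Entropy

open InformationTheory

/-- With f the truncation of log ρ to [-n, n], the expression equals klFun(e^f) + (ρ - e^f) f. The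
second term is nonnegative because truncation from below happens where ρ ≤ e^f and f ≤ 0, and
truncation from above where ρ ≥ e^f and f ≥ 0. This sign is what allows Fatou's lemma below. The
inner maximum avoids the logarithm of 0. -/
lemma mul_log_sub_add_one_nonneg_of_truncation {ρ : ℝ} (n : ℕ) :
    0 ≤ ρ * min (n : ℝ) (Real.log (max ρ (Real.exp (-n)))) -
      Real.exp (min (n : ℝ) (Real.log (max ρ (Real.exp (-n))))) + 1 := by
  set f := min (n : ℝ) (Real.log (max ρ (Real.exp (-n)))) with hf
  have hn : (0 : ℝ) ≤ n := n.cast_nonneg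
  have hkl : 0 ≤ klFun (Real.exp f) := klFun_nonneg (Real.exp_pos f).le
  rw [klFun, Real.log_exp] at hkl
  suffices 0 ≤ (ρ - Real.exp f) * f by linarith
  rcases le_total ρ (Real.exp (-n)) with h | h
  · have : f = -n := by
      rw [hf, max_eq_right h, Real.log_exp, min_eq_right (by linarith)]
    rw [this]
    exact mul_nonneg_of_nonpos_of_nonpos (by linarith) (by linarith)
  · have hρ : 0 < ρ := (Real.exp_pos _).trans_le h
    rw [max_eq_left h] at hf
    rcases le_total (Real.log ρ) n with h' | h'
    · rw [hf, min_eq_right h', Real.exp_log hρ, sub_self, zero_mul]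
    · rw [hf, min_eq_left h']
      refine mul_nonneg (sub_nonneg.2 ?_) hn
      rwa [← Real.le_log_iff_exp_le hρ]

lemma tendsto_truncation_klFun {ρ : ℝ} (hρ : 0 ≤ ρ) :
    Tendsto (fun n : ℕ => ρ * min (n : ℝ) (Real.log (max ρ (Real.exp (-n)))) -
      Real.exp (min (n : ℝ) (Real.log (max ρ (Real.exp (-n))))) + 1) atTop (𝓝 (klFun ρ)) := by
  have hexp : Tendsto (fun n : ℕ => Real.exp (-(n : ℝ))) atTop (𝓝 0) :=
    Real.tendsto_exp_neg_atTop_nhds_zero.comp tendsto_natCast_atTop_atTop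
  rcases hρ.eq_or_lt with rfl | hρ
  · have : Tendsto (fun n : ℕ => -Real.exp (-(n : ℝ)) + 1) atTop (𝓝 (klFun 0)) := by
      simpa [klFun] using hexp.neg.add_const 1
    refine this.congr fun n => ?_
    have hn : (0 : ℝ) ≤ n := n.cast_nonneg
    rw [max_eq_right (Real.exp_pos _).le, Real.log_exp, min_eq_right (by linarith)]
    ring
  · refine tendsto_const_nhds.congr' ?_
    filter_upwards [hexp.eventually_le_const hρ,
      tendsto_natCast_atTop_atTop.eventually_ge_atTop (Real.log ρ)] with n h1 h2
    rw [max_eq_left h1, min_eq_right h2, Real.exp_log hρ, klFun]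
    ring

variable {X : Type*} [MeasurableSpace X]

/-- The formal optimizer is f = log dμ/dμ₀. Its truncations are bounded, and Fatou's lemma shows
that their values exceed any c below the entropy. If μ is not absolutely continuous, large multiples
of the indicator of a μ₀-null set charged by μ do the same. -/
lemma exists_bounded_measurable_lt_of_lt_klDiv (μ μ₀ : Measure X) [IsProbabilityMeasure μ]
    [IsProbabilityMeasure μ₀] {c : ℝ} (hc : (c : EReal) < (klDiv μ μ₀ : EReal)) :
    ∃ (f : X → ℝ) (K : ℝ), Measurable f ∧ (∀ x, |f x| ≤ K) ∧
      c < ∫ x, f x ∂μ - ∫ x, (Real.exp (f x) - 1) ∂μ₀ := by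
  -- Negative c is served by f = 0; the Fatou argument takes place in `ℝ≥0∞` and needs c ≥ 0.
  rcases lt_or_ge c 0 with hc0 | hc0
  · exact ⟨fun _ => 0, 0, measurable_const, by simp, by simpa using hc0⟩
  by_cases hac : μ ≪ μ₀
  · set ρ : X → ℝ := fun x => (μ.rnDeriv μ₀ x).toReal with hρ
    have hρm : Measurable ρ := (Measure.measurable_rnDeriv μ μ₀).ennreal_toReal
    set f : ℕ → X → ℝ := fun n x => min (n : ℝ) (Real.log (max (ρ x) (Real.exp (-n)))) with hf
    have hfm : ∀ n, Measurable (f n) := fun n => by fun_prop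
    have hfb : ∀ n x, |f n x| ≤ n := fun n x => by
      refine abs_le.2 ⟨le_min (by linarith [n.cast_nonneg (α := ℝ)]) ?_, min_le_left _ _⟩
      rw [Real.le_log_iff_exp_le (lt_max_of_lt_right (Real.exp_pos _))]
      exact le_max_right _ _
    have hfi : ∀ n (ν : Measure X) [IsFiniteMeasure ν], Integrable (f n) ν := fun n ν _ =>
      Integrable.of_bound (hfm n).aestronglyMeasurable n (ae_of_all _ (hfb n))
    have hei : ∀ n, Integrable (fun x => Real.exp (f n x)) μ₀ := fun n =>
      Integrable.of_bound (hfm n).exp.aestronglyMeasurable (Real.exp n) (ae_of_all _ fun x => by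
        rw [Real.norm_of_nonneg (Real.exp_pos _).le]
        exact Real.exp_le_exp.2 (abs_le.1 (hfb n x)).2)
    have hri : ∀ n, Integrable (fun x => ρ x * f n x) μ₀ := fun n =>
      (integrable_rnDeriv_smul_iff hac).2 (hfi n μ)
    set L : ℕ → X → ℝ := fun n x => ρ x * f n x - Real.exp (f n x) + 1 with hL
    have hLi : ∀ n, Integrable (L n) μ₀ := fun n =>
      ((hri n).sub (hei n)).add (integrable_const 1)
    have hLval : ∀ n, ∫ x, L n x ∂μ₀ = ∫ x, f n x ∂μ - ∫ x, (Real.exp (f n x) - 1) ∂μ₀ :=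
      fun n => by
        have h1 : ∫ x, ρ x * f n x ∂μ₀ = ∫ x, f n x ∂μ := integral_rnDeriv_smul hac
        have hei' : Integrable (fun x => Real.exp (f n x) - 1) μ₀ :=
          (hei n).sub (integrable_const 1)
        rw [← h1, ← integral_sub (hri n) hei']
        refine integral_congr_ae (ae_of_all _ fun x => ?_)
        simp only [hL]
        ring
    have hlt : ENNReal.ofReal c < ∫⁻ x, liminf (fun n => ENNReal.ofReal (L n x)) atTop ∂μ₀ := by
      have h1 : ∀ x, liminf (fun n => ENNReal.ofReal (L n x)) atTop =
          ENNReal.ofReal (klFun (ρ x)) := fun x =>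
        (ENNReal.tendsto_ofReal (tendsto_truncation_klFun ENNReal.toReal_nonneg)).liminf_eq
      simp_rw [h1]
      rw [← klDiv_eq_lintegral_klFun_of_ac hac, ← EReal.coe_ennreal_lt_coe_ennreal_iff,
        EReal.coe_ennreal_ofReal, max_eq_left hc0]
      exact hc
    obtain ⟨n, hn⟩ := (eventually_lt_of_lt_liminf (hlt.trans_le (lintegral_liminf_le fun n =>
      (((hρm.mul (hfm n)).sub (hfm n).exp).add_const 1).ennreal_ofReal))).exists
    refine ⟨f n, n, hfm n, hfb n, ?_⟩
    rw [← hLval]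
    rw [← ofReal_integral_eq_lintegral_ofReal (hLi n)
      (ae_of_all _ fun x => mul_log_sub_add_one_nonneg_of_truncation n)] at hn
    exact (ENNReal.ofReal_lt_ofReal_iff_of_nonneg hc0).1 hn
  · obtain ⟨A, hA, hA0, hA1⟩ : ∃ A, MeasurableSet A ∧ μ₀ A = 0 ∧ μ A ≠ 0 := by
      by_contra! h
      exact hac (Measure.AbsolutelyContinuous.mk fun s hs h0 => h s hs h0)
    have hpos : 0 < μ.real A := by
      rw [measureReal_def]
      exact ENNReal.toReal_pos hA1 (measure_ne_top _ _)
    obtain ⟨n, hn⟩ := exists_nat_gt (c / μ.real A)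
    refine ⟨A.indicator fun _ => (n : ℝ), n, measurable_const.indicator hA, fun x => ?_, ?_⟩
    · by_cases hx : x ∈ A <;> simp [hx]
    · have h1 : ∫ x, (Real.exp (A.indicator (fun _ => (n : ℝ)) x) - 1) ∂μ₀ = 0 := by
        refine integral_eq_zero_of_ae ?_
        have : ∀ᵐ x ∂μ₀, x ∉ A := measure_eq_zero_iff_ae_notMem.1 hA0
        filter_upwards [this] with x hx
        simp [hx]
      rw [h1, sub_zero, integral_indicator_const _ hA, smul_eq_mul, mul_comm]
      exact (div_lt_iff₀ hpos).1 hn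

/-- The variational lower bound for the relative entropy by continuous functions. -/
theorem exists_continuous_lt_of_lt_klDiv [TopologicalSpace X] [CompactSpace X] [MetrizableSpace X]
    [BorelSpace X] (μ μ₀ : Measure X) [IsProbabilityMeasure μ] [IsProbabilityMeasure μ₀] {c : ℝ}
    (hc : (c : EReal) < (klDiv μ μ₀ : EReal)) :
    ∃ f : C(X, ℝ), c < ∫ x, f x ∂μ - ∫ x, (Real.exp (f x) - 1) ∂μ₀ := by
  obtain ⟨f, K, hfm, hfb, hlt⟩ := exists_bounded_measurable_lt_of_lt_klDiv μ μ₀ hc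
  set s := ∫ x, f x ∂μ - ∫ x, (Real.exp (f x) - 1) ∂μ₀
  have hfi : Integrable f (μ + μ₀) :=
    Integrable.of_bound hfm.aestronglyMeasurable K (ae_of_all _ hfb)
  -- An L¹ error ε costs at most ε in the linear term and e^K ε in the exponential one, so half of
  -- the gap s - c survives.
  set ε := (s - c) / (2 * (1 + Real.exp K)) with hε
  have hεpos : 0 < ε := div_pos (sub_pos.2 hlt) (by positivity)
  obtain ⟨g, hg, -⟩ := hfi.exists_boundedContinuous_integral_sub_le hεpos
  -- Clamping does not increase the distance to f, and it gives the bound e^K on the slope of the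
  -- exponential.
  let h : C(X, ℝ) := ⟨fun x => max (-K) (min K (g x)), by fun_prop⟩
  have hbd : ∀ x, |h x| ≤ K := fun x => by
    have hK : 0 ≤ K := (abs_nonneg _).trans (hfb x)
    exact abs_le.2 ⟨le_max_left _ _, max_le (by linarith) (min_le_left _ _)⟩
  have hclose : ∀ x, |f x - h x| ≤ |f x - g x| := fun x => by
    have h1 : f x = max (-K) (min K (f x)) := by
      rw [min_eq_right (abs_le.1 (hfb x)).2, max_eq_right (abs_le.1 (hfb x)).1]
    calc |f x - h x| = |max (-K) (min K (f x)) - max (-K) (min K (g x))| := by rw [← h1]; rfl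
      _ ≤ |min K (f x) - min K (g x)| := (abs_max_sub_max_le_max _ _ _ _).trans (by simp)
      _ ≤ |f x - g x| := (abs_min_sub_min_le_max _ _ _ _).trans (by simp)
  have hδ : Integrable (fun x => |f x - g x|) (μ + μ₀) :=
    (hfi.sub (BoundedContinuousFunction.integrable _ g)).abs
  have hδμ : Integrable (fun x => |f x - g x|) μ := hδ.left_of_add_measure
  have hδμ₀ : Integrable (fun x => |f x - g x|) μ₀ := hδ.right_of_add_measure
  have hsum : ∫ x, |f x - g x| ∂μ + ∫ x, |f x - g x| ∂μ₀ ≤ ε := by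
    rw [← integral_add_measure hδμ hδμ₀]
    exact hg
  have hhi : ∀ (ν : Measure X) [IsFiniteMeasure ν], Integrable h ν := fun ν _ =>
    Integrable.of_bound h.continuous.aestronglyMeasurable K (ae_of_all _ hbd)
  have hexp : ∀ u : X → ℝ, Measurable u → (∀ x, |u x| ≤ K) →
      Integrable (fun x => Real.exp (u x) - 1) μ₀ := fun u hu hub =>
    (Integrable.of_bound hu.exp.aestronglyMeasurable (Real.exp K) (ae_of_all _ fun x => by
      rw [Real.norm_of_nonneg (Real.exp_pos _).le]
      exact Real.exp_le_exp.2 (abs_le.1 (hub x)).2)).sub (integrable_const 1)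
  have hfe := hexp f hfm hfb
  have hhe := hexp h h.continuous.measurable hbd
  have h1 : ∫ x, f x ∂μ - ∫ x, h x ∂μ ≤ ∫ x, |f x - g x| ∂μ := by
    rw [← integral_sub hfi.left_of_add_measure (hhi μ)]
    exact integral_mono (hfi.left_of_add_measure.sub (hhi μ)) hδμ
      fun x => (le_abs_self _).trans (hclose x)
  have h2 : ∫ x, (Real.exp (h x) - 1) ∂μ₀ - ∫ x, (Real.exp (f x) - 1) ∂μ₀ ≤
      Real.exp K * ∫ x, |f x - g x| ∂μ₀ := by
    rw [← integral_sub hhe hfe, ← integral_const_mul]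
    refine integral_mono (hhe.sub hfe) (hδμ₀.const_mul _) fun x => ?_
    have e1 : Real.exp (h x) - Real.exp (f x) ≤ Real.exp (h x) * |f x - h x| := by
      have e2 : Real.exp (f x) = Real.exp (h x) * Real.exp (f x - h x) := by
        rw [← Real.exp_add]; congr 1; ring
      have e3 := Real.add_one_le_exp (f x - h x)
      have e4 : 1 - Real.exp (f x - h x) ≤ |f x - h x| := by
        linarith [neg_abs_le (f x - h x)]
      rw [e2]
      nlinarith [Real.exp_pos (h x)]
    have e5 : Real.exp (h x) ≤ Real.exp K := Real.exp_le_exp.2 (abs_le.1 (hbd x)).2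
    calc Real.exp (h x) - 1 - (Real.exp (f x) - 1) = Real.exp (h x) - Real.exp (f x) := by ring
      _ ≤ Real.exp (h x) * |f x - h x| := e1
      _ ≤ Real.exp K * |f x - g x| :=
        mul_le_mul e5 (hclose x) (abs_nonneg _) (Real.exp_pos _).le
  refine ⟨h, ?_⟩
  have h3 : 0 ≤ ∫ x, |f x - g x| ∂μ := integral_nonneg fun x => abs_nonneg _
  have h4 : 0 ≤ ∫ x, |f x - g x| ∂μ₀ := integral_nonneg fun x => abs_nonneg _
  have hK := Real.exp_pos K
  have h5 : ε * (2 * (1 + Real.exp K)) = s - c := by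
    rw [hε]
    field_simp
  nlinarith

end Entropy
end MeanFieldGibbs

namespace MeanFieldGibbs

/-! ### Lower semicontinuous integrands -/

section LowerSemicontinuous

/-- The integral of a lower semicontinuous function is approximated from below by integrals of
continuous functions. -/
theorem exists_continuous_le_lt_lintegral {Y : Type*} [TopologicalSpace Y]
    [CompactSpace Y] [MetrizableSpace Y] [MeasurableSpace Y] [BorelSpace Y] {φ : Y → ℝ≥0∞}
    (hφ : LowerSemicontinuous φ) (ν : Measure Y) {c : ℝ≥0∞} (hc : c < ∫⁻ y, φ y ∂ν) :
    ∃ g : C(Y, ℝ), (∀ y, 0 ≤ g y) ∧ (∀ y, ENNReal.ofReal (g y) ≤ φ y) ∧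
      c < ∫⁻ y, ENNReal.ofReal (g y) ∂ν := by
  let := metrizableSpaceMetric Y
  set T : ℕ → Y → ℝ := fun n y => (min (φ y) n).toReal with hT
  have hT0 : ∀ n y, 0 ≤ T n y := fun n y => ENNReal.toReal_nonneg
  have hfin : ∀ (n : ℕ) y, min (φ y) n ≠ ⊤ := fun n y =>
    ((min_le_right _ _).trans_lt (ENNReal.natCast_lt_top n)).ne
  have hbdd : ∀ (n : ℕ) x, BddBelow (Set.range fun y => T n y + n * dist x y) := fun n x =>
    ⟨0, by rintro _ ⟨y, rfl⟩; have := hT0 n y; positivity⟩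
  -- Inf-convolution of min(φ, n) with n · dist: it is n-Lipschitz, increases with n, and by lower
  -- semicontinuity has supremum φ, so monotone convergence applies.
  set G : ℕ → Y → ℝ := fun n x => ⨅ y, (T n y + n * dist x y) with hG
  have hGle : ∀ n x y, G n x ≤ T n y + n * dist x y := fun n x y => ciInf_le (hbdd n x) y
  have hleG : ∀ n x (a : ℝ), (∀ y, a ≤ T n y + n * dist x y) → a ≤ G n x := fun n x a h => by
    have : Nonempty Y := ⟨x⟩
    exact le_ciInf h
  have hG0 : ∀ n x, 0 ≤ G n x := fun n x => hleG n x 0 fun y => by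
    have := hT0 n y; positivity
  have hGcont : ∀ n, Continuous (G n) := fun n => by
    refine (LipschitzWith.of_le_add_mul (n : NNReal) fun x x' => ?_).continuous
    rw [← sub_le_iff_le_add]
    refine hleG n x' _ fun y => ?_
    have h1 := hGle n x y
    have h2 := mul_le_mul_of_nonneg_left (dist_triangle x x' y) (n.cast_nonneg (α := ℝ))
    simp only [NNReal.coe_natCast]
    linarith
  have hGφ : ∀ n y, ENNReal.ofReal (G n y) ≤ φ y := fun n y => by
    have h1 : G n y ≤ T n y := by simpa using hGle n y y
    calc ENNReal.ofReal (G n y) ≤ ENNReal.ofReal (T n y) := ENNReal.ofReal_le_ofReal h1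
      _ = min (φ y) n := ENNReal.ofReal_toReal (hfin n y)
      _ ≤ φ y := min_le_left _ _
  have hmono : Monotone fun n y => ENNReal.ofReal (G n y) := fun n k hnk y => by
    refine ENNReal.ofReal_le_ofReal (hleG k y _ fun z => (hGle n y z).trans ?_)
    have h1 : T n z ≤ T k z := ENNReal.toReal_mono (hfin k z)
      (min_le_min le_rfl (by exact_mod_cast hnk))
    gcongr
  have hsup : ∀ y, ⨆ n, ENNReal.ofReal (G n y) = φ y := fun y => by
    refine le_antisymm (iSup_le fun n => hGφ n y) (le_of_forall_lt fun d hd => ?_)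
    obtain ⟨d', hdd', hd'⟩ := exists_between hd
    lift d' to NNReal using hd'.ne_top
    obtain ⟨δ, hδ, hball⟩ := Metric.eventually_nhds_iff.1 (hφ y d' hd')
    -- Within δ of y the truncation at n still leaves a value at least d'; farther away the penalty
    -- nδ is already at least d'.
    obtain ⟨n, hn⟩ := exists_nat_ge (max (d' : ℝ) (d' / δ))
    refine hdd'.trans_le (le_iSup_of_le n ?_)
    rw [← ENNReal.ofReal_coe_nnreal]
    refine ENNReal.ofReal_le_ofReal (hleG n y _ fun z => ?_)
    by_cases hz : dist z y < δ
    · have h1 : (d' : ℝ) ≤ T n z := by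
        have h2 : (d' : ℝ≥0∞) ≤ min (φ z) n := le_min (hball hz).le (by
          have := (le_max_left _ _).trans hn
          exact_mod_cast this)
        simpa using ENNReal.toReal_mono (hfin n z) h2
      have : 0 ≤ (n : ℝ) * dist y z := by positivity
      linarith
    · have h1 : (d' : ℝ) ≤ n * δ := (div_le_iff₀ hδ).1 ((le_max_right _ _).trans hn)
      have h2 : (n : ℝ) * δ ≤ n * dist y z := by
        rw [dist_comm]
        exact mul_le_mul_of_nonneg_left (not_lt.1 hz) n.cast_nonneg
      linarith [hT0 n z]
  have hint : ∫⁻ y, φ y ∂ν = ⨆ n, ∫⁻ y, ENNReal.ofReal (G n y) ∂ν := by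
    rw [← lintegral_iSup (fun n => (hGcont n).measurable.ennreal_ofReal) hmono]
    simp_rw [hsup]
  rw [hint] at hc
  obtain ⟨n, hn⟩ := lt_iSup_iff.1 hc
  exact ⟨⟨G n, hGcont n⟩, hG0 n, hGφ n, hn⟩

lemma exists_real_le_of_lowerSemicontinuous {Y : Type*} [TopologicalSpace Y] [CompactSpace Y]
    {W : Y → EReal} (hW : LowerSemicontinuous W) (hbot : ∀ y, W y ≠ ⊥) :
    ∃ C : ℝ, 0 ≤ C ∧ ∀ y, ((-C : ℝ) : EReal) ≤ W y := by
  rcases isEmpty_or_nonempty Y with hY | hY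
  · exact ⟨0, le_rfl, fun y => hY.elim y⟩
  obtain ⟨y₀, -, hy₀⟩ := (hW.lowerSemicontinuousOn Set.univ).exists_isMinOn Set.univ_nonempty
    isCompact_univ
  obtain ⟨c, hc⟩ := EReal.lt_iff_exists_real_btwn.1 (bot_lt_iff_ne_bot.2 (hbot y₀))
  refine ⟨max (-c) 0, le_max_right _ _, fun y => ?_⟩
  refine le_trans ?_ (hc.2.le.trans (hy₀ (Set.mem_univ y)))
  rw [EReal.coe_le_coe_iff]
  linarith [le_max_left (-c) 0]

lemma toENNReal_add_coe_add_toENNReal_neg {w : EReal} {C : ℝ} (hC : 0 ≤ C)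
    (hw : ((-C : ℝ) : EReal) ≤ w) :
    (w + C).toENNReal + (-w).toENNReal = w.toENNReal + ENNReal.ofReal C := by
  induction w with
  | bot => simp at hw
  | top => simp
  | coe w =>
    rw [EReal.coe_le_coe_iff] at hw
    rw [← EReal.coe_add, ← EReal.coe_neg]
    simp only [EReal.toENNReal_of_ne_top (EReal.coe_ne_top _), EReal.toReal_coe]
    rcases le_total 0 w with h | h
    · rw [ENNReal.ofReal_of_nonpos (by linarith : -w ≤ 0), add_zero, ENNReal.ofReal_add h hC]
    · rw [ENNReal.ofReal_of_nonpos h, zero_add, ← ENNReal.ofReal_add (by linarith) (by linarith)]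
      congr 1
      ring

/-- Integrate (w + C)⁺ + w⁻ = w⁺ + C; the term w⁻ ≤ C has finite integral and may be cancelled.
Energies thereby become integrals of nonnegative functions, with no ∞ - ∞ to track. -/
theorem eintegral_eq_lintegral_sub {Z : Type*} [MeasurableSpace Z] (ν : Measure Z)
    [IsProbabilityMeasure ν] {W : Z → EReal} (hW : Measurable W) {C : ℝ} (hC : 0 ≤ C)
    (hb : ∀ z, ((-C : ℝ) : EReal) ≤ W z) :
    eintegral ν W = ((∫⁻ z, (W z + C).toENNReal ∂ν : ℝ≥0∞) : EReal) - C := by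
  have h1 : ∫⁻ z, (W z + C).toENNReal ∂ν + ∫⁻ z, (-W z).toENNReal ∂ν =
      ∫⁻ z, (W z).toENNReal ∂ν + ENNReal.ofReal C := by
    have hm : Measurable fun z => (-W z).toENNReal := by fun_prop
    rw [← lintegral_add_right _ hm]
    simp_rw [toENNReal_add_coe_add_toENNReal_neg hC (hb _)]
    rw [lintegral_add_right _ measurable_const]
    simp
  have h2 : ∫⁻ z, (-W z).toENNReal ∂ν ≤ ENNReal.ofReal C := by
    calc ∫⁻ z, (-W z).toENNReal ∂ν ≤ ∫⁻ _, ENNReal.ofReal C ∂ν := by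
          refine lintegral_mono fun z => ?_
          rw [← EReal.toReal_coe C, ← EReal.toENNReal_of_ne_top (EReal.coe_ne_top C)]
          refine EReal.toENNReal_le_toENNReal ?_
          rw [EReal.neg_le, ← EReal.coe_neg]
          exact hb z
      _ = ENNReal.ofReal C := by simp
  have h3 : ∫⁻ z, (-W z).toENNReal ∂ν ≠ ⊤ := (h2.trans_lt ENNReal.ofReal_lt_top).ne
  rw [eintegral]
  set A := ∫⁻ z, (W z + C).toENNReal ∂ν
  set P := ∫⁻ z, (W z).toENNReal ∂ν
  lift (∫⁻ z, (-W z).toENNReal ∂ν) to NNReal using h3 with B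
  rcases eq_or_ne A ⊤ with hA | hA
  · have hP : P = ⊤ := by simpa [hA] using h1.symm
    simp [hA, hP]
  · have hP : P ≠ ⊤ := fun hP => by simp [hP, hA] at h1
    lift A to NNReal using hA with A'
    lift P to NNReal using hP with P'
    have h4 : (A' : ℝ) + B = P' + C := by
      have := congrArg ENNReal.toReal h1
      rwa [ENNReal.toReal_add (by simp) (by simp), ENNReal.toReal_add (by simp) (by simp),
        ENNReal.toReal_ofReal hC] at this
    change ((P' : ℝ) : EReal) - ((B : ℝ) : EReal) = ((A' : ℝ) : EReal) - C
    rw [← EReal.coe_sub, ← EReal.coe_sub, EReal.coe_eq_coe_iff]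
    linarith

/-- A lower semicontinuous function is approximated from below by continuous functions, in the
sense of the integral. -/
theorem exists_continuous_le_lt_eintegral {Y : Type*} [TopologicalSpace Y]
    [CompactSpace Y] [MetrizableSpace Y] [MeasurableSpace Y] [BorelSpace Y] {W : Y → EReal}
    (hW : LowerSemicontinuous W) (hbot : ∀ y, W y ≠ ⊥) (ν : Measure Y) [IsProbabilityMeasure ν]
    {e : ℝ} (he : (e : EReal) < eintegral ν W) :
    ∃ g : C(Y, ℝ), (∀ y, (g y : EReal) ≤ W y) ∧ e < ∫ y, g y ∂ν := by
  obtain ⟨C, hC, hb⟩ := exists_real_le_of_lowerSemicontinuous hW hbot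
  rcases lt_or_ge (e + C) 0 with h0 | h0
  · exact ⟨ContinuousMap.const Y (-C), hb, by simp; linarith⟩
  set φ : Y → ℝ≥0∞ := fun y => (W y + C).toENNReal with hφ
  have hlsc : LowerSemicontinuous φ := by
    refine EReal.continuous_toENNReal.comp_lowerSemicontinuous
      (hW.add' lowerSemicontinuous_const fun y => ?_) fun _ _ h => EReal.toENNReal_le_toENNReal h
    exact EReal.continuousAt_add (Or.inr (EReal.coe_ne_bot _)) (Or.inr (EReal.coe_ne_top _))
  have hlt : ENNReal.ofReal (e + C) < ∫⁻ y, φ y ∂ν := by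
    rw [eintegral_eq_lintegral_sub ν hW.measurable hC hb] at he
    rw [← EReal.coe_ennreal_lt_coe_ennreal_iff, EReal.coe_ennreal_ofReal, max_eq_left h0]
    have := EReal.add_lt_add_right_coe he C
    rwa [EReal.sub_add_cancel, ← EReal.coe_add] at this
  obtain ⟨g, hg0, hgφ, hg⟩ := exists_continuous_le_lt_lintegral hlsc ν hlt
  have hgi : Integrable g ν := g.continuous.integrable_of_hasCompactSupport
    (HasCompactSupport.of_compactSpace g)
  refine ⟨g - ContinuousMap.const Y C, fun y => ?_, ?_⟩
  · have h1 : (g y : EReal) ≤ W y + C := by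
      have h2 := EReal.coe_ennreal_le_coe_ennreal_iff.2 (hgφ y)
      rw [EReal.coe_ennreal_ofReal, max_eq_left (hg0 y)] at h2
      refine h2.trans (le_of_eq (EReal.coe_toENNReal ?_))
      have := add_le_add_left (hb y) (C : EReal)
      rwa [← EReal.coe_add, neg_add_cancel, EReal.coe_zero] at this
    simp only [ContinuousMap.coe_sub, Pi.sub_apply, ContinuousMap.const_apply, EReal.coe_sub]
    exact (EReal.sub_le_iff_le_add (Or.inl (EReal.coe_ne_bot _))
      (Or.inl (EReal.coe_ne_top _))).2 h1
  · rw [← ofReal_integral_eq_lintegral_ofReal hgi (ae_of_all _ hg0),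
      ENNReal.ofReal_lt_ofReal_iff_of_nonneg h0] at hg
    simp only [ContinuousMap.coe_sub, Pi.sub_apply, ContinuousMap.const_apply]
    rw [integral_sub hgi (integrable_const C)]
    simp
    linarith

end LowerSemicontinuous
end MeanFieldGibbs

namespace MeanFieldGibbs

/-! ### Product measures and empirical means -/

section Products

variable {X : Type*} [MeasurableSpace X]

/-- On boxes the density times the indicator is a product of functions of single coordinates, and
these are independent. It serves both the change of measure and the conditioning argument. -/
lemma pi_withDensity {ι : Type*} [Fintype ι] (μ : Measure X) [IsProbabilityMeasure μ]
    {ρ : X → ℝ≥0∞} (hρ : Measurable ρ) [IsFiniteMeasure (μ.withDensity ρ)] :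
    Measure.pi (fun _ : ι => μ.withDensity ρ) =
      (Measure.pi fun _ : ι => μ).withDensity fun x => ∏ i, ρ (x i) := by
  refine Measure.pi_eq fun s hs => ?_
  rw [withDensity_apply _ (MeasurableSet.univ_pi hs), ← lintegral_indicator (.univ_pi hs)]
  have h1 : (Set.univ.pi s).indicator (fun x : ι → X => ∏ i, ρ (x i)) =
      fun x => ∏ i, (s i).indicator ρ (x i) := by
    ext x
    by_cases hx : x ∈ Set.univ.pi s
    · rw [Set.indicator_of_mem hx]
      exact Finset.prod_congr rfl fun i _ => (Set.indicator_of_mem (hx i trivial) _).symm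
    · rw [Set.indicator_of_notMem hx]
      simp only [Set.mem_pi, Set.mem_univ, true_imp_iff, not_forall] at hx
      obtain ⟨i, hi⟩ := hx
      exact (Finset.prod_eq_zero (Finset.mem_univ i) (Set.indicator_of_notMem hi _)).symm
  have hm : ∀ i, Measurable ((s i).indicator ρ) := fun i => hρ.indicator (hs i)
  rw [h1, ProbabilityTheory.lintegral_prod_eq_prod_lintegral_of_indepFun Finset.univ
    (fun i (x : ι → X) => (s i).indicator ρ (x i))
    (ProbabilityTheory.iIndepFun_pi fun i => (hm i).aemeasurable)
    (fun i => (hm i).comp (measurable_pi_apply i))]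
  refine Finset.prod_congr rfl fun i _ => ?_
  rw [(measurePreserving_eval (fun _ : ι => μ) i).lintegral_comp (hm i),
    lintegral_indicator (hs i), withDensity_apply _ (hs i)]

/-- Distinct coordinates are independent. This is why each term of the Hamiltonian, having pairwise
distinct indices, has mean exactly E(ν) under ν^{⊗N}. -/
lemma measurePreserving_pi_comp {ι κ : Type*} [Fintype ι] [Fintype κ] (μ : Measure X)
    [IsProbabilityMeasure μ] {I : κ → ι} (hI : Function.Injective I) :
    MeasurePreserving (fun (x : ι → X) k => x (I k)) (Measure.pi fun _ => μ)
      (Measure.pi fun _ => μ) := by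
  refine ⟨by fun_prop, ?_⟩
  have h1 : ProbabilityTheory.iIndepFun (fun i (x : ι → X) => x i) (Measure.pi fun _ : ι => μ) :=
    ProbabilityTheory.iIndepFun_pi (X := fun _ => id) fun i => aemeasurable_id
  have h2 := (ProbabilityTheory.iIndepFun_iff_map_fun_eq_pi_map
    (fun k => (measurable_pi_apply (I k)).aemeasurable)).1 (h1.precomp hI)
  rw [h2]
  congr 1
  ext1 k
  exact (measurePreserving_eval (fun _ : ι => μ) (I k)).map_eq

lemma integral_empiricalMeasure (N : ℕ+) (x : Fin N → X) {f : X → ℝ} (hf : StronglyMeasurable f) :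
    ∫ y, f y ∂(empiricalMeasure N x : Measure X) = (N : ℝ)⁻¹ * ∑ i, f (x i) := by
  have h1 : (empiricalMeasure N x : Measure X) = (N : ℝ≥0∞)⁻¹ • ∑ i, Measure.dirac (x i) := rfl
  rw [h1, integral_smul_measure, integral_finsetSum_measure]
  · simp [integral_dirac' _ _ hf]
  · exact fun i _ => integrable_dirac' hf (by simp)

/-- The sum runs over all multi-indices, repetitions included, so the energy of δ_N differs from H/N
by the diagonal terms. -/
lemma pi_empiricalMeasure (N : ℕ+) (m : ℕ) (x : Fin N → X) :
    Measure.pi (fun _ : Fin m => (empiricalMeasure N x : Measure X)) =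
      ((N : ℝ≥0∞)⁻¹ ^ m) • ∑ I : Fin m → Fin N, Measure.dirac fun k => x (I k) := by
  refine Measure.pi_eq fun s hs => ?_
  have h1 : ∀ k, (empiricalMeasure N x : Measure X) (s k) =
      (N : ℝ≥0∞)⁻¹ * ∑ i, (s k).indicator 1 (x i) := fun k => by
    change ((N : ℝ≥0∞)⁻¹ • ∑ i, Measure.dirac (x i)) (s k) = _
    simp [Measure.dirac_apply' _ (hs k)]
  simp_rw [h1]
  rw [Finset.prod_mul_distrib, Finset.prod_univ_sum]
  simp only [Finset.prod_const, Finset.card_univ, Fintype.card_fin, Fintype.piFinset_univ,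
    Measure.smul_apply, Measure.coe_finsetSum, Finset.sum_apply, smul_eq_mul]
  congr 1
  refine Finset.sum_congr rfl fun I _ => ?_
  rw [Measure.dirac_apply' _ (MeasurableSet.univ_pi hs)]
  by_cases h : (fun k => x (I k)) ∈ Set.univ.pi s
  · rw [Set.indicator_of_mem h]
    refine (Finset.prod_eq_one fun k _ => ?_).symm
    rw [Set.indicator_of_mem (h k trivial), Pi.one_apply]
  · rw [Set.indicator_of_notMem h]
    simp only [Set.mem_pi, Set.mem_univ, true_imp_iff, not_forall] at h
    obtain ⟨k, hk⟩ := h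
    exact (Finset.prod_eq_zero (Finset.mem_univ k) (Set.indicator_of_notMem hk _)).symm

lemma integral_pi_empiricalMeasure (N : ℕ+) (m : ℕ) (x : Fin N → X) {g : (Fin m → X) → ℝ}
    (hg : StronglyMeasurable g) :
    ∫ y, g y ∂(Measure.pi fun _ : Fin m => (empiricalMeasure N x : Measure X)) =
      (N : ℝ)⁻¹ ^ m * ∑ I : Fin m → Fin N, g fun k => x (I k) := by
  rw [pi_empiricalMeasure, integral_smul_measure, integral_finsetSum_measure]
  · simp [integral_dirac' _ _ hg]
  · exact fun i _ => integrable_dirac' hg (by simp)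

/-- The quotient is the proportion of multi-indices with distinct entries; its limit 1 makes the
diagonals negligible. -/
lemma tendsto_descFactorial_div_pow (m : ℕ) :
    Tendsto (fun N : ℕ+ => ((N : ℕ).descFactorial m : ℝ) / (N : ℝ) ^ m) atTop (𝓝 1) := by
  have h := (Asymptotics.isEquivalent_iff_tendsto_one ?_).1 (isEquivalent_descFactorial m)
  · exact h.comp tendsto_PNat_val_atTop_atTop
  · filter_upwards [eventually_gt_atTop 0] with n hn
    positivity

/-- Chernoff's bound for empirical means. -/
lemma pi_lt_empiricalMean_le (μ₀ : Measure X) [IsProbabilityMeasure μ₀] (N : ℕ+) {f : X → ℝ}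
    (hf : Measurable f) {K : ℝ} (hK : ∀ x, |f x| ≤ K) (s : ℝ) :
    (Measure.pi fun _ : Fin N => μ₀) {x | s < (N : ℝ)⁻¹ * ∑ i, f (x i)} ≤
      ENNReal.ofReal (Real.exp (-(N * (s - ∫ x, (Real.exp (f x) - 1) ∂μ₀)))) := by
  have hei : Integrable (fun x => Real.exp (f x)) μ₀ :=
    Integrable.of_bound hf.exp.aestronglyMeasurable (Real.exp K) (ae_of_all _ fun x => by
      rw [Real.norm_of_nonneg (Real.exp_pos _).le]
      exact Real.exp_le_exp.2 (abs_le.1 (hK x)).2)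
  have hN : (0 : ℝ) < N := by exact_mod_cast N.pos
  have hexp : ∀ x : Fin N → X, Real.exp (1 * ∑ i, f (x i)) = ∏ i, Real.exp (f (x i)) := fun x => by
    rw [one_mul, Real.exp_sum]
  have hint : Integrable (fun x : Fin N → X => Real.exp (1 * ∑ i, f (x i)))
      (Measure.pi fun _ => μ₀) := by
    simp_rw [hexp]
    exact Integrable.fintype_prod (fun _ => hei)
  have h1 := ProbabilityTheory.measure_ge_le_exp_mul_mgf (N * s) zero_le_one hint
  rw [ProbabilityTheory.mgf] at h1
  simp_rw [hexp] at h1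
  rw [integral_fintype_prod_eq_pow (fun x => Real.exp (f x)), Fintype.card_fin] at h1
  -- The inequality z ≤ e^{z - 1} replaces log ∫ e^f by ∫ (e^f - 1), the form used in the duality
  -- for the entropy.
  have h2 : ∫ x, Real.exp (f x) ∂μ₀ ≤ Real.exp (∫ x, (Real.exp (f x) - 1) ∂μ₀) := by
    rw [integral_sub hei (integrable_const 1)]
    have := Real.add_one_le_exp (∫ x, Real.exp (f x) ∂μ₀ - 1)
    simpa using this
  have h3 : (∫ x, Real.exp (f x) ∂μ₀) ^ (N : ℕ) ≤
      Real.exp (∫ x, (Real.exp (f x) - 1) ∂μ₀) ^ (N : ℕ) :=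
    pow_le_pow_left₀ (integral_nonneg fun x => (Real.exp_pos _).le) h2 _
  rw [← ENNReal.ofReal_toReal (measure_ne_top _ {x : Fin N → X | s < (N : ℝ)⁻¹ * ∑ i, f (x i)})]
  refine ENNReal.ofReal_le_ofReal ?_
  calc (Measure.pi fun _ : Fin N => μ₀).real {x | s < (N : ℝ)⁻¹ * ∑ i, f (x i)}
      ≤ (Measure.pi fun _ : Fin N => μ₀).real {x | N * s ≤ ∑ i, f (x i)} := by
        refine measureReal_mono fun x hx => ?_
        have hx' : s < (N : ℝ)⁻¹ * ∑ i, f (x i) := hx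
        rw [← div_eq_inv_mul, lt_div_iff₀ hN] at hx'
        change N * s ≤ ∑ i, f (x i)
        linarith
    _ ≤ Real.exp (-1 * (N * s)) * (∫ x, Real.exp (f x) ∂μ₀) ^ (N : ℕ) := h1
    _ ≤ Real.exp (-1 * (N * s)) * Real.exp (∫ x, (Real.exp (f x) - 1) ∂μ₀) ^ (N : ℕ) := by gcongr
    _ = Real.exp (-(N * (s - ∫ x, (Real.exp (f x) - 1) ∂μ₀))) := by
        rw [← Real.exp_nat_mul, ← Real.exp_add]
        congr 1
        ring

/-- Chebyshev's bound for empirical means. -/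
lemma pi_le_abs_empiricalMean_sub_le (μ : Measure X) [IsProbabilityMeasure μ] (N : ℕ+) {f : X → ℝ}
    (hf : Measurable f) {K : ℝ} (hK : ∀ x, |f x| ≤ K) {c : ℝ} (hc : 0 < c) :
    (Measure.pi fun _ : Fin N => μ) {x | c ≤ |(N : ℝ)⁻¹ * ∑ i, f (x i) - ∫ x, f x ∂μ|} ≤
      ENNReal.ofReal ((N : ℝ)⁻¹ * (ProbabilityTheory.variance f μ / c ^ 2)) := by
  have hN : (0 : ℝ) < N := by exact_mod_cast N.pos
  have hfL : MemLp f 2 μ := MemLp.of_bound hf.aestronglyMeasurable K (ae_of_all _ hK)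
  have hfi : Integrable f μ := hfL.integrable (by norm_num)
  set S : (Fin N → X) → ℝ := ∑ i, fun x => f (x i) with hS
  have hSapp : ∀ x, S x = ∑ i, f (x i) := fun x => by simp [hS]
  have hcomp : ∀ i, MemLp (fun x : Fin N → X => f (x i)) 2 (Measure.pi fun _ => μ) := fun i =>
    hfL.comp_measurePreserving (measurePreserving_eval (fun _ : Fin N => μ) i)
  have hSL : MemLp S 2 (Measure.pi fun _ => μ) := memLp_finsetSum' _ fun i _ => hcomp i
  have hvar : ProbabilityTheory.variance S (Measure.pi fun _ => μ) =
      N * ProbabilityTheory.variance f μ := by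
    rw [hS, ProbabilityTheory.variance_sum_pi (X := fun _ : Fin N => f) fun _ => hfL]
    simp
  have hmean : ∫ x, S x ∂(Measure.pi fun _ : Fin N => μ) = N * ∫ x, f x ∂μ := by
    simp_rw [hSapp]
    rw [integral_finsetSum _ fun i _ => (hcomp i).integrable (by norm_num)]
    have : ∀ i : Fin N, ∫ x : Fin N → X, f (x i) ∂(Measure.pi fun _ : Fin N => μ) = ∫ x, f x ∂μ :=
      fun i => integral_comp_eval (μ := fun _ : Fin N => μ) hf.aestronglyMeasurable
    simp [this]
  have h := ProbabilityTheory.meas_ge_le_variance_div_sq hSL (c := N * c) (by positivity)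
  rw [hvar, hmean] at h
  refine (measure_mono fun x hx => ?_).trans (h.trans (le_of_eq ?_))
  · change N * c ≤ |S x - N * ∫ x, f x ∂μ|
    rw [hSapp]
    have h1 : ∑ i, f (x i) - N * ∫ x, f x ∂μ =
        N * ((N : ℝ)⁻¹ * ∑ i, f (x i) - ∫ x, f x ∂μ) := by
      field_simp
    rw [h1, abs_mul, abs_of_pos hN]
    exact mul_le_mul_of_nonneg_left hx hN.le
  · congr 1
    field_simp

variable [TopologicalSpace X]

lemma continuous_empiricalMeasure [SecondCountableTopology X] [OpensMeasurableSpace X] (N : ℕ+) :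
    Continuous (empiricalMeasure (X := X) N) := by
  rw [ProbabilityMeasure.continuous_iff_forall_continuous_integral]
  intro f
  simp_rw [integral_empiricalMeasure N _ f.continuous.stronglyMeasurable]
  fun_prop

lemma continuous_integral_pi [SecondCountableTopology X] [PseudoMetrizableSpace X] [CompactSpace X]
    [BorelSpace X] {m : ℕ} (g : C(Fin m → X, ℝ)) :
    Continuous fun μ : ProbabilityMeasure X =>
      ∫ y, g y ∂(Measure.pi fun _ : Fin m => (μ : Measure X)) := by
  have h1 : Continuous fun μ : ProbabilityMeasure X => ProbabilityMeasure.pi fun _ : Fin m => μ :=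
    ProbabilityMeasure.continuous_pi.comp (continuous_pi fun _ => continuous_id)
  exact (ProbabilityMeasure.continuous_integral_continuousMap g).comp h1

/-- The law of large numbers: the empirical measures of an i.i.d. sample converge in probability
to the sampled law. -/
theorem tendsto_pi_empiricalMeasure_notMem [CompactSpace X] [MetrizableSpace X] [BorelSpace X]
    (μ : ProbabilityMeasure X) {G : Set (ProbabilityMeasure X)} (hG : IsOpen G) (hμ : μ ∈ G) :
    Tendsto (fun N : ℕ+ => (Measure.pi fun _ : Fin N => (μ : Measure X))
      {x | empiricalMeasure N x ∉ G}) atTop (𝓝 0) := by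
  refine hG.isClosed_compl.isCompact.induction_on
    (p := fun S => Tendsto (fun N : ℕ+ => (Measure.pi fun _ : Fin N => (μ : Measure X))
      {x | empiricalMeasure N x ∈ S}) atTop (𝓝 0)) (by simp) ?_ ?_ ?_
  · intro S T hST hT
    exact tendsto_of_tendsto_of_tendsto_of_le_of_le tendsto_const_nhds hT (fun _ => zero_le)
      fun N => measure_mono fun x hx => hST hx
  · intro S T hS hT
    have := hS.add hT
    rw [add_zero] at this
    exact tendsto_of_tendsto_of_tendsto_of_le_of_le tendsto_const_nhds this (fun _ => zero_le)
      fun N => measure_union_le _ _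
  -- One test function separates ν from μ, and Chebyshev's bound of order 1/N excludes a
  -- neighbourhood of ν; compactness of the complement of `G` does the rest.
  · intro ν hν
    have hne : (ν : Measure X) ≠ μ := fun h => hν (by
      rw [ProbabilityMeasure.toMeasure_injective h]; exact hμ)
    obtain ⟨f, hf⟩ : ∃ f : BoundedContinuousFunction X ℝ,
        ∫ x, f x ∂(ν : Measure X) ≠ ∫ x, f x ∂(μ : Measure X) := by
      by_contra! h
      exact hne (ext_of_forall_integral_eq_of_IsFiniteMeasure h)
    set c := |∫ x, f x ∂(ν : Measure X) - ∫ x, f x ∂(μ : Measure X)| / 2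
    have hc : 0 < c := half_pos (abs_pos.2 (sub_ne_zero.2 hf))
    have hcont : Continuous fun ν : ProbabilityMeasure X =>
        |∫ x, f x ∂(ν : Measure X) - ∫ x, f x ∂(μ : Measure X)| :=
      ((ProbabilityMeasure.continuous_integral_boundedContinuousFunction f).sub
        continuous_const).abs
    refine ⟨{ν' | c < |∫ x, f x ∂(ν' : Measure X) - ∫ x, f x ∂(μ : Measure X)|},
      mem_nhdsWithin_of_mem_nhds ((isOpen_lt continuous_const hcont).mem_nhds
        (half_lt_self (abs_pos.2 (sub_ne_zero.2 hf)))), ?_⟩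
    have hlim : Tendsto (fun N : ℕ+ => ENNReal.ofReal ((N : ℝ)⁻¹ *
        (ProbabilityTheory.variance f (μ : Measure X) / c ^ 2))) atTop (𝓝 0) := by
      have h1 : Tendsto (fun N : ℕ+ => ((N : ℕ) : ℝ)⁻¹) atTop (𝓝 0) :=
        tendsto_inv_atTop_nhds_zero_nat.comp tendsto_PNat_val_atTop_atTop
      have h2 := ENNReal.tendsto_ofReal (h1.mul_const
        (ProbabilityTheory.variance f (μ : Measure X) / c ^ 2))
      simpa using h2
    refine tendsto_of_tendsto_of_tendsto_of_le_of_le tendsto_const_nhds hlim (fun _ => zero_le)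
      fun N => (measure_mono fun x hx => ?_).trans
        (pi_le_abs_empiricalMean_sub_le (μ : Measure X) N f.continuous.measurable
          (K := ‖f‖) f.norm_coe_le_norm hc)
    have hx' : c < |∫ y, f y ∂(empiricalMeasure N x : Measure X) - ∫ y, f y ∂(μ : Measure X)| := hx
    rw [integral_empiricalMeasure N x f.continuous.stronglyMeasurable] at hx'
    exact hx'.le

end Products
end MeanFieldGibbs

namespace MeanFieldGibbs

/-! ### Local upper bound and lower semicontinuity of the rate -/

section Upper

lemma coe_finsetSum {ι : Type*} (s : Finset ι) (f : ι → ℝ) :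
    ((∑ i ∈ s, f i : ℝ) : EReal) = ∑ i ∈ s, (f i : EReal) :=
  map_sum (⟨⟨fun x : ℝ => (x : EReal), EReal.coe_zero⟩, EReal.coe_add⟩ : ℝ →+ EReal) f s

/-- Separates the energy from the entropy so that each can be bounded by its own test function. The
cases are needed because either value may be infinite, and t · D = 0 when t = 0 even if D = ∞. -/
lemma exists_real_lt_of_lt_add_mul {E D : EReal} (hE : E ≠ ⊥) (hD : 0 ≤ D) {t a : ℝ} (ht : 0 ≤ t)
    (h : (a : EReal) < E + t * D) :
    ∃ e d : ℝ, (e : EReal) < E ∧ (d : EReal) < D ∧ a < e + t * d := by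
  have hneg : ((-1 : ℝ) : EReal) < D := lt_of_lt_of_le (by exact_mod_cast neg_one_lt_zero) hD
  induction E with
  | bot => exact absurd rfl hE
  -- The value -1 lies below every D ≥ 0, and e makes up for the loss t.
  | top => exact ⟨a + t + 1, -1, EReal.coe_lt_top _, hneg, by linarith⟩
  | coe E =>
    induction D with
    | bot => simp at hD
    | top =>
      rcases ht.eq_or_lt with rfl | ht
      · rw [EReal.coe_zero, zero_mul, add_zero, EReal.coe_lt_coe_iff] at h
        exact ⟨(a + E) / 2, 0, by rw [EReal.coe_lt_coe_iff]; linarith, EReal.coe_lt_top _,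
          by linarith⟩
      · refine ⟨E - 1, (a - E + 2) / t, by rw [EReal.coe_lt_coe_iff]; linarith,
          EReal.coe_lt_top _, ?_⟩
        rw [mul_div_cancel₀ _ ht.ne']
        linarith
    | coe D =>
      rw [← EReal.coe_mul, ← EReal.coe_add, EReal.coe_lt_coe_iff] at h
      -- Lowering both E and D by this amount uses exactly half of the gap.
      have hpos : 0 < (E + t * D - a) / (2 * (t + 1)) := div_pos (by linarith) (by linarith)
      have hval : (E + t * D - a) / (2 * (t + 1)) * (2 * (t + 1)) = E + t * D - a :=
        div_mul_cancel₀ _ (by linarith)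
      refine ⟨E - (E + t * D - a) / (2 * (t + 1)), D - (E + t * D - a) / (2 * (t + 1)), ?_, ?_, ?_⟩
      · rw [EReal.coe_lt_coe_iff]; linarith
      · rw [EReal.coe_lt_coe_iff]; linarith
      · nlinarith

lemma eintegral_mono {Z : Type*} [MeasurableSpace Z] (ν : Measure Z) {f g : Z → EReal}
    (h : ∀ z, f z ≤ g z) : eintegral ν f ≤ eintegral ν g := by
  refine EReal.sub_le_sub ?_ ?_ <;> rw [EReal.coe_ennreal_le_coe_ennreal_iff] <;>
    refine lintegral_mono fun z => EReal.toENNReal_le_toENNReal ?_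
  · exact h z
  · exact EReal.neg_le_neg_iff.2 (h z)

lemma eintegral_coe {Z : Type*} [MeasurableSpace Z] {ν : Measure Z} {g : Z → ℝ}
    (hg : Integrable g ν) : eintegral ν (fun z => (g z : EReal)) = ((∫ z, g z ∂ν : ℝ) : EReal) := by
  have h1 : ∫⁻ z, ENNReal.ofReal (g z) ∂ν ≠ ⊤ := hg.lintegral_lt_top.ne
  have h2 : ∫⁻ z, ENNReal.ofReal (-g z) ∂ν ≠ ⊤ := hg.neg.lintegral_lt_top.ne
  rw [integral_eq_lintegral_pos_part_sub_lintegral_neg_part hg, eintegral, EReal.coe_sub,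
    EReal.coe_ennreal_toReal h1, EReal.coe_ennreal_toReal h2]
  simp only [← EReal.coe_neg, EReal.real_coe_toENNReal]

lemma neg_le_energy {X : Type*} [MeasurableSpace X] {m : ℕ} {W : (Fin m → X) → EReal} {C : ℝ}
    (hC : ∀ x, ((-C : ℝ) : EReal) ≤ W x) (μ : ProbabilityMeasure X) :
    ((-C : ℝ) : EReal) ≤ energy W μ := by
  have h := eintegral_mono (Measure.pi fun _ : Fin m => (μ : Measure X)) hC
  rw [eintegral_coe (integrable_const _)] at h
  simpa [energy] using h

/-- Young's inequality ρ f ≤ klFun ρ + (e^f - 1), integrated against μ₀ with ρ = dν/dμ₀. This easy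
half of the duality keeps the entropy above d on a whole neighbourhood. -/
lemma integral_sub_integral_exp_le_klDiv {X : Type*} [MeasurableSpace X] (ν μ₀ : Measure X)
    [IsProbabilityMeasure ν] [IsProbabilityMeasure μ₀] {f : X → ℝ} (hf : Measurable f) {K : ℝ}
    (hK : ∀ x, |f x| ≤ K) :
    ((∫ x, f x ∂ν - ∫ x, (Real.exp (f x) - 1) ∂μ₀ : ℝ) : EReal) ≤
      (InformationTheory.klDiv ν μ₀ : EReal) := by
  rcases eq_or_ne (InformationTheory.klDiv ν μ₀) ⊤ with h | h
  · rw [h]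
    exact le_top
  obtain ⟨hac, hint⟩ := InformationTheory.klDiv_ne_top_iff.1 h
  have hei : Integrable (fun x => Real.exp (f x)) μ₀ :=
    Integrable.of_bound hf.exp.aestronglyMeasurable (Real.exp K) (ae_of_all _ fun x => by
      rw [Real.norm_of_nonneg (Real.exp_pos _).le]
      exact Real.exp_le_exp.2 (abs_le.1 (hK x)).2)
  have hei' : Integrable (fun x => Real.exp (f x) - 1) μ₀ := hei.sub (integrable_const 1)
  have hfi : Integrable f ν := Integrable.of_bound hf.aestronglyMeasurable K (ae_of_all _ hK)
  have hki := (InformationTheory.integrable_klFun_rnDeriv_iff hac).2 hint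
  rw [← EReal.coe_ennreal_toReal h, EReal.coe_le_coe_iff,
    InformationTheory.toReal_klDiv_eq_integral_klFun hac, sub_le_iff_le_add,
    ← integral_add hki hei', ← integral_rnDeriv_smul hac]
  refine integral_mono ((integrable_rnDeriv_smul_iff hac).2 hfi) (hki.add hei') fun x => ?_
  have hρ : 0 ≤ (ν.rnDeriv μ₀ x).toReal := ENNReal.toReal_nonneg
  simp only [smul_eq_mul, InformationTheory.klFun]
  rcases hρ.eq_or_lt with h0 | h0
  · rw [← h0]
    simp [(Real.exp_pos _).le]
  · set ρ := (ν.rnDeriv μ₀ x).toReal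
    have h1 : Real.exp (f x) = ρ * Real.exp (f x - Real.log ρ) := by
      rw [Real.exp_sub, Real.exp_log h0]
      field_simp
    have h2 := Real.add_one_le_exp (f x - Real.log ρ)
    nlinarith

variable {X : Type*} [TopologicalSpace X] [CompactSpace X] [MetrizableSpace X]
  [MeasurableSpace X] [BorelSpace X]

lemma measurable_empiricalMeasure_borel (N : ℕ+) :
    @Measurable _ _ _ (borel (ProbabilityMeasure X)) (empiricalMeasure (X := X) N) := by
  have h := (continuous_empiricalMeasure (X := X) N).borel_measurable
  rwa [← BorelSpace.measurable_eq (α := Fin N → X)] at h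

lemma empiricalLaw_apply (N : ℕ+) (ν : Measure (Fin N → X)) {S : Set (ProbabilityMeasure X)}
    (hS : @MeasurableSet _ (borel _) S) :
    empiricalLaw N ν S = ν (empiricalMeasure N ⁻¹' S) :=
  @Measure.map_apply _ _ _ (borel _) _ _ (measurable_empiricalMeasure_borel N) _ hS

/-- The Hamiltonian is bounded below by the energy of the empirical measure, up to the
contribution of the diagonals. -/
lemma le_hamiltonian_of_continuous_le {m : ℕ} (hm : 1 ≤ m) {W : (Fin m → X) → EReal}
    {g : C(Fin m → X, ℝ)} (hg : ∀ y, (g y : EReal) ≤ W y) (N : ℕ+) (x : Fin N → X) :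
    ((N * (∫ y, g y ∂(Measure.pi fun _ : Fin m => (empiricalMeasure N x : Measure X)) -
      ‖g‖ * (1 - (N : ℕ).descFactorial m / (N : ℝ) ^ m)) : ℝ) : EReal) ≤ hamiltonian W N x := by
  have hN : (0 : ℝ) < N := by exact_mod_cast N.pos
  have h1 : ((1 / (N : ℝ) ^ (m - 1) * ∑ I : Fin m ↪ Fin N, g fun k => x (I k) : ℝ) : EReal) ≤
      hamiltonian W N x := by
    rw [hamiltonian, EReal.coe_mul, coe_finsetSum]
    refine mul_le_mul_of_nonneg_left (Finset.sum_le_sum fun I _ => hg _) ?_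
    exact_mod_cast (by positivity : (0 : ℝ) ≤ 1 / (N : ℝ) ^ (m - 1))
  refine le_trans (EReal.coe_le_coe_iff.2 ?_) h1
  rw [integral_pi_empiricalMeasure N m x g.continuous.stronglyMeasurable]
  -- The summands ‖g‖ - g are nonnegative, so dropping the diagonal multi-indices can only decrease
  -- the sum.
  have h2 : ∑ I : Fin m ↪ Fin N, (‖g‖ - g fun k => x (I k)) ≤
      ∑ I : Fin m → Fin N, (‖g‖ - g fun k => x (I k)) := by
    have := Finset.sum_le_univ_sum_of_nonneg (s := Finset.univ.map
      (⟨fun I k => I k, DFunLike.coe_injective⟩ : (Fin m ↪ Fin N) ↪ (Fin m → Fin N)))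
      (f := fun I : Fin m → Fin N => ‖g‖ - g fun k => x (I k))
      (fun I => sub_nonneg.2 ((le_abs_self _).trans (g.norm_coe_le_norm _)))
    simpa using this
  simp only [Finset.sum_sub_distrib, Finset.sum_const, Finset.card_univ, nsmul_eq_mul,
    Fintype.card_embedding_eq, Fintype.card_fin, Fintype.card_fun] at h2
  push_cast at h2
  have h3 : (N : ℝ) ^ m = N * (N : ℝ) ^ (m - 1) := by
    rw [← pow_succ', Nat.sub_add_cancel hm]
  set A := ∑ I : Fin m ↪ Fin N, g fun k => x (I k)
  set B := ∑ I : Fin m → Fin N, g fun k => x (I k)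
  have h4 : (N : ℝ) * (((N : ℝ)⁻¹) ^ m * B -
      ‖g‖ * (1 - ((N : ℕ).descFactorial m : ℝ) / (N : ℝ) ^ m)) =
      1 / (N : ℝ) ^ (m - 1) * (B - ‖g‖ * ((N : ℝ) ^ m - (N : ℕ).descFactorial m)) := by
    rw [inv_pow, h3]
    field_simp
  rw [h4]
  refine mul_le_mul_of_nonneg_left ?_ (by positivity)
  linarith

/-- The local upper bound for the non-normalized Gibbs measures. -/
theorem exists_nhds_empiricalLaw_gibbsWeight_le (μ₀ : Measure X) [IsProbabilityMeasure μ₀]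
    {m : ℕ} (hm : 1 ≤ m) {W : (Fin m → X) → EReal} (hbot : ∀ x, W x ≠ ⊥)
    (hW : LowerSemicontinuous W) {β : ℕ+ → ℝ} (hβ : ∀ N, 0 < β N) {t : ℝ} (ht : 0 ≤ t)
    (hβt : Tendsto (fun N => 1 / β N) atTop (𝓝 t))
    (μ : ProbabilityMeasure X) {a : ℝ}
    (ha : (a : EReal) < energy W μ + t * (InformationTheory.klDiv (μ : Measure X) μ₀ : EReal)) :
    ∃ U, IsOpen U ∧ μ ∈ U ∧ (∀ ν ∈ U, (a : EReal) <
      energy W ν + t * (InformationTheory.klDiv (ν : Measure X) μ₀ : EReal)) ∧ ∀ᶠ N in atTop,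
      empiricalLaw N (gibbsWeight μ₀ W (β N) N) U ≤
        ENNReal.ofReal (Real.exp (-(β N * N * a))) := by
  obtain ⟨C, -, hC⟩ := exists_real_le_of_lowerSemicontinuous hW hbot
  have hE : energy W μ ≠ ⊥ := ((EReal.bot_lt_coe _).trans_le (neg_le_energy hC μ)).ne'
  obtain ⟨e, d, he, hd, hlt⟩ := exists_real_lt_of_lt_add_mul hE (EReal.coe_ennreal_nonneg _)
    ht ha
  obtain ⟨g, hgW, hg⟩ := exists_continuous_le_lt_eintegral hW hbot
    (Measure.pi fun _ : Fin m => (μ : Measure X)) he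
  obtain ⟨f, hf⟩ := exists_continuous_lt_of_lt_klDiv (μ : Measure X) μ₀ hd
  set q := ∫ x, (Real.exp (f x) - 1) ∂μ₀ with hq
  have hcf := ProbabilityMeasure.continuous_integral_continuousMap f
  have hcg := continuous_integral_pi g
  -- The threshold d + q is chosen so that both Chernoff's bound and the duality return exactly d.
  set U : Set (ProbabilityMeasure X) := {ν | d + q < ∫ x, f x ∂(ν : Measure X)} ∩
    {ν | e < ∫ y, g y ∂(Measure.pi fun _ : Fin m => (ν : Measure X))} with hU
  have hUo : IsOpen U := (isOpen_lt continuous_const hcf).inter (isOpen_lt continuous_const hcg)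
  refine ⟨U, hUo, ⟨by change d + q < _; linarith, hg⟩, ?_, ?_⟩
  · intro ν hν
    have h1 : (d : EReal) < (InformationTheory.klDiv (ν : Measure X) μ₀ : EReal) := by
      refine lt_of_lt_of_le ?_ (integral_sub_integral_exp_le_klDiv (ν : Measure X) μ₀
        f.continuous.measurable (K := ‖f‖) f.norm_coe_le_norm)
      have : d + q < ∫ x, f x ∂(ν : Measure X) := hν.1
      rw [EReal.coe_lt_coe_iff]
      linarith
    have h2 : (e : EReal) < energy W ν := by
      have h3 : e < ∫ y, g y ∂(Measure.pi fun _ : Fin m => (ν : Measure X)) := hν.2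
      refine (EReal.coe_lt_coe_iff.2 h3).trans_le ?_
      rw [← eintegral_coe (g.continuous.integrable_of_hasCompactSupport
        (HasCompactSupport.of_compactSpace g))]
      exact eintegral_mono _ hgW
    calc (a : EReal) < ((e + t * d : ℝ) : EReal) := EReal.coe_lt_coe_iff.2 hlt
      _ = e + t * d := by rw [EReal.coe_add, EReal.coe_mul]
      _ ≤ _ := add_le_add h2.le (mul_le_mul_of_nonneg_left h1.le (by exact_mod_cast ht))
  -- This is the exponent per unit of speed: energy minus the diagonal error, plus 1/β_N times the
  -- entropy.
  · have hlim : Tendsto (fun N : ℕ+ =>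
        e - ‖g‖ * (1 - (N : ℕ).descFactorial m / (N : ℝ) ^ m) + 1 / β N * d) atTop
        (𝓝 (e - ‖g‖ * (1 - 1) + t * d)) :=
      (((tendsto_descFactorial_div_pow m).const_sub 1).const_mul ‖g‖).const_sub e |>.add
        (hβt.mul_const d)
    have hlt' : a < e - ‖g‖ * (1 - 1) + t * d := by linarith
    filter_upwards [hlim.eventually_const_lt hlt'] with N hN
    have hNpos : (0 : ℝ) < N := by exact_mod_cast N.pos
    set η := ‖g‖ * (1 - (N : ℕ).descFactorial m / (N : ℝ) ^ m) with hη
    have hUm : MeasurableSet (empiricalMeasure (X := X) N ⁻¹' U) :=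
      (hUo.preimage (continuous_empiricalMeasure N)).measurableSet
    rw [empiricalLaw_apply N _ (MeasurableSpace.measurableSet_generateFrom hUo), gibbsWeight,
      withDensity_apply _ hUm]
    calc ∫⁻ x in empiricalMeasure N ⁻¹' U, EReal.exp (-((β N : EReal) * hamiltonian W N x))
          ∂(Measure.pi fun _ : Fin N => μ₀)
        ≤ ∫⁻ x in empiricalMeasure N ⁻¹' U, ENNReal.ofReal (Real.exp (-(β N * (N * (e - η)))))
          ∂(Measure.pi fun _ : Fin N => μ₀) := by
          refine setLIntegral_mono measurable_const fun x hx => ?_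
          rw [← EReal.exp_coe]
          refine EReal.exp_monotone ?_
          rw [EReal.coe_neg, EReal.neg_le_neg_iff, EReal.coe_mul]
          refine mul_le_mul_of_nonneg_left ?_ (by exact_mod_cast (hβ N).le)
          refine le_trans (EReal.coe_le_coe_iff.2 ?_) (le_hamiltonian_of_continuous_le hm hgW N x)
          have hx2 : e < ∫ y, g y ∂(Measure.pi fun _ : Fin m =>
            (empiricalMeasure N x : Measure X)) := hx.2
          rw [← hη]
          gcongr
      _ = ENNReal.ofReal (Real.exp (-(β N * (N * (e - η))))) *
          (Measure.pi fun _ : Fin N => μ₀) (empiricalMeasure N ⁻¹' U) := by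
          rw [setLIntegral_const]
      _ ≤ ENNReal.ofReal (Real.exp (-(β N * (N * (e - η))))) *
          ENNReal.ofReal (Real.exp (-(N * d))) := by
          gcongr
          refine (measure_mono fun x hx => ?_).trans ((pi_lt_empiricalMean_le μ₀ N
            f.continuous.measurable (K := ‖f‖) f.norm_coe_le_norm (d + q)).trans (le_of_eq ?_))
          · have hx1 : d + q < ∫ y, f y ∂(empiricalMeasure N x : Measure X) := hx.1
            rwa [integral_empiricalMeasure N x f.continuous.stronglyMeasurable] at hx1
          · rw [← hq, add_sub_cancel_right]
      _ ≤ ENNReal.ofReal (Real.exp (-(β N * N * a))) := by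
          rw [← ENNReal.ofReal_mul (Real.exp_pos _).le, ← Real.exp_add]
          refine ENNReal.ofReal_le_ofReal (Real.exp_le_exp.2 ?_)
          have h1 : β N * N * a ≤ β N * N * (e - η + 1 / β N * d) :=
            mul_le_mul_of_nonneg_left hN.le (mul_pos (hβ N) hNpos).le
          have h2 : β N * N * (e - η + 1 / β N * d) = β N * (N * (e - η)) + N * d := by
            have := (hβ N).ne'
            field_simp
          linarith

end Upper
end MeanFieldGibbs

noncomputable section

namespace MeanFieldGibbs

/-! ### Change of measure and moment estimates -/

section Lower

open InformationTheory

/-- The mean field Hamiltonian of a nonnegative extended-real interaction. -/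
def nonnegHamiltonian {X : Type*} {m : ℕ} (φ : (Fin m → X) → ℝ≥0∞) (N : ℕ) (x : Fin N → X) :
    ℝ≥0∞ :=
  ENNReal.ofReal (1 / (N : ℝ) ^ (m - 1)) * ∑ I : Fin m ↪ Fin N, φ fun k => x (I k)

/-- Adding C to W adds C once for each injective multi-index, and there are `descFactorial` many.
Finiteness of the shifted sum makes every term real, so the subtraction is legitimate. -/
lemma hamiltonian_eq_nonnegHamiltonian_sub {X : Type*} {m : ℕ} (hm : 1 ≤ m)
    {W : (Fin m → X) → EReal} (hbot : ∀ y, W y ≠ ⊥) {C : ℝ} (hC : ∀ y, ((-C : ℝ) : EReal) ≤ W y)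
    (N : ℕ+) (x : Fin N → X)
    (hx : nonnegHamiltonian (fun y => (W y + C).toENNReal) N x ≠ ⊤) :
    hamiltonian W N x = (((nonnegHamiltonian (fun y => (W y + C).toENNReal) N x).toReal -
      N * (C * ((N : ℕ).descFactorial m / (N : ℝ) ^ m)) : ℝ) : EReal) := by
  have hN : (0 : ℝ) < N := by exact_mod_cast N.pos
  have hpos : ENNReal.ofReal (1 / (N : ℝ) ^ (m - 1)) ≠ 0 := by
    rw [Ne, ENNReal.ofReal_eq_zero, not_le]
    positivity
  have hsum : ∑ I : Fin m ↪ Fin N, (W (fun k => x (I k)) + C).toENNReal ≠ ⊤ := fun h =>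
    hx (by rw [nonnegHamiltonian, h, ENNReal.mul_top hpos])
  have hfin : ∀ I : Fin m ↪ Fin N, (W (fun k => x (I k)) + C).toENNReal ≠ ⊤ := fun I =>
    (ENNReal.sum_lt_top.1 hsum.lt_top I (Finset.mem_univ I)).ne
  have hW : ∀ I : Fin m ↪ Fin N, W (fun k => x (I k)) =
      (((W (fun k => x (I k)) + C).toENNReal.toReal - C : ℝ) : EReal) := fun I => by
    have h1 := hfin I
    have h2 := hC fun k => x (I k)
    have h3 : W (fun k => x (I k)) ≠ ⊤ := fun h => h1 (by simp [h])
    lift W (fun k => x (I k)) to ℝ using ⟨h3, hbot _⟩ with w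
    rw [EReal.coe_le_coe_iff] at h2
    rw [← EReal.coe_add, EReal.real_coe_toENNReal, ENNReal.toReal_ofReal (by linarith),
      add_sub_cancel_right]
  have h3 : (N : ℝ) ^ m = N * (N : ℝ) ^ (m - 1) := by
    rw [← pow_succ', Nat.sub_add_cancel hm]
  rw [hamiltonian, Finset.sum_congr rfl fun I _ => hW I, ← coe_finsetSum, ← EReal.coe_mul,
    EReal.coe_eq_coe_iff, nonnegHamiltonian, ENNReal.toReal_mul,
    ENNReal.toReal_ofReal (by positivity), ENNReal.toReal_sum fun I _ => hfin I,
    Finset.sum_sub_distrib, Finset.sum_const, Finset.card_univ, Fintype.card_embedding_eq,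
    Fintype.card_fin, Fintype.card_fin, nsmul_eq_mul, h3]
  field_simp

variable {X : Type*} [MeasurableSpace X]

lemma measurable_nonnegHamiltonian {m : ℕ} {φ : (Fin m → X) → ℝ≥0∞} (hφ : Measurable φ) (N : ℕ) :
    Measurable (nonnegHamiltonian φ N) :=
  (Finset.measurable_sum _ fun _ _ => hφ.comp (by fun_prop)).const_mul _

lemma lintegral_nonnegHamiltonian_le {m : ℕ} (hm : 1 ≤ m) {φ : (Fin m → X) → ℝ≥0∞}
    (hφ : Measurable φ) (ν : Measure X) [IsProbabilityMeasure ν] (N : ℕ+) :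
    ∫⁻ x, nonnegHamiltonian φ N x ∂(Measure.pi fun _ : Fin N => ν) ≤
      N * ∫⁻ y, φ y ∂(Measure.pi fun _ : Fin m => ν) := by
  have hN : (0 : ℝ) < N := by exact_mod_cast N.pos
  have h1 : ∀ I : Fin m ↪ Fin N, Measurable fun x : Fin N → X => φ fun k => x (I k) := fun I =>
    hφ.comp (by fun_prop)
  simp only [nonnegHamiltonian]
  rw [lintegral_const_mul _ (Finset.measurable_sum _ fun I _ => h1 I),
    lintegral_finsetSum _ fun I _ => h1 I]
  have h2 : ∀ I : Fin m ↪ Fin N, ∫⁻ x, φ (fun k => x (I k)) ∂(Measure.pi fun _ : Fin N => ν) =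
      ∫⁻ y, φ y ∂(Measure.pi fun _ : Fin m => ν) := fun I =>
    (measurePreserving_pi_comp ν I.injective).lintegral_comp hφ
  simp_rw [h2]
  rw [Finset.sum_const, Finset.card_univ, Fintype.card_embedding_eq, Fintype.card_fin,
    Fintype.card_fin, nsmul_eq_mul, ← mul_assoc]
  gcongr
  rw [← ENNReal.ofReal_natCast ((N : ℕ).descFactorial m), ← ENNReal.ofReal_mul (by positivity),
    ← ENNReal.ofReal_natCast N]
  refine ENNReal.ofReal_le_ofReal ?_
  rw [one_div, inv_mul_le_iff₀ (by positivity), ← pow_succ, Nat.sub_add_cancel hm]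
  exact_mod_cast Nat.descFactorial_le_pow N m

/-- The density of ν^{⊗N} is the product of the dν/dμ₀(x_i). Only an inequality holds, since
`Real.log 0 = 0` turns a vanishing density into the factor 1. -/
lemma pi_le_lintegral_exp_llr {ν μ₀ : Measure X} [IsProbabilityMeasure ν]
    [IsProbabilityMeasure μ₀] (hac : ν ≪ μ₀) (N : ℕ) {B : Set (Fin N → X)} (hB : MeasurableSet B) :
    (Measure.pi fun _ : Fin N => ν) B ≤
      ∫⁻ x in B, ENNReal.ofReal (Real.exp (∑ i, llr ν μ₀ (x i)))
        ∂(Measure.pi fun _ : Fin N => μ₀) := by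
  have hwd : μ₀.withDensity (ν.rnDeriv μ₀) = ν := Measure.withDensity_rnDeriv_eq ν μ₀ hac
  have : IsFiniteMeasure (μ₀.withDensity (ν.rnDeriv μ₀)) := by rw [hwd]; infer_instance
  have h1 := pi_withDensity (ι := Fin N) μ₀ (Measure.measurable_rnDeriv ν μ₀)
  rw [hwd] at h1
  rw [h1, withDensity_apply _ hB]
  refine lintegral_mono_ae (ae_restrict_of_ae ?_)
  have h2 : ∀ i : Fin N, ∀ᵐ x ∂(Measure.pi fun _ : Fin N => μ₀), ν.rnDeriv μ₀ (x i) < ⊤ := fun i =>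
    (measurePreserving_eval (fun _ : Fin N => μ₀) i).quasiMeasurePreserving.ae
      (Measure.rnDeriv_lt_top ν μ₀)
  filter_upwards [ae_all_iff.2 h2] with x hx
  rw [Real.exp_sum, ENNReal.ofReal_prod_of_nonneg fun i _ => (Real.exp_pos _).le]
  refine Finset.prod_le_prod' fun i _ => ?_
  rw [← ENNReal.ofReal_toReal (hx i).ne, llr]
  refine ENNReal.ofReal_le_ofReal ?_
  rcases (ENNReal.toReal_nonneg (a := ν.rnDeriv μ₀ (x i))).eq_or_lt with h | h
  · rw [← h]
    exact (Real.exp_pos _).le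
  · rw [Real.exp_log h]

/-- Markov's inequality needs a nonnegative variable, so the positive part of S = ∑ llr must be
controlled. It is at most S + e^{-S}, where S has mean N · D and e^{-S} has mean at most 1, because
e^{-llr} is ν-a.e. the density dμ₀/dν. The cost is a single unit, whatever N is. -/
lemma lintegral_ofReal_sum_llr_le {ν μ₀ : Measure X} [IsProbabilityMeasure ν]
    [IsProbabilityMeasure μ₀] (h : klDiv ν μ₀ ≠ ⊤) (N : ℕ) :
    ∫⁻ x, ENNReal.ofReal (∑ i, llr ν μ₀ (x i)) ∂(Measure.pi fun _ : Fin N => ν) ≤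
      ENNReal.ofReal (N * (klDiv ν μ₀).toReal + 1) := by
  obtain ⟨hac, hint⟩ := klDiv_ne_top_iff.1 h
  have hee := exp_neg_llr hac
  have hei : Integrable (fun x => Real.exp (-llr ν μ₀ x)) ν :=
    Measure.integrable_toReal_rnDeriv.congr hee.symm
  have hev : ∫ x, Real.exp (-llr ν μ₀ x) ∂ν ≤ 1 := by
    rw [integral_congr_ae hee]
    simpa using Measure.setIntegral_toReal_rnDeriv_le (μ := μ₀) (ν := ν) (s := Set.univ) (by simp)
  have hcomp : ∀ i : Fin N, Integrable (fun x : Fin N → X => llr ν μ₀ (x i))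
      (Measure.pi fun _ => ν) := fun i =>
    (measurePreserving_eval (fun _ : Fin N => ν) i).integrable_comp_of_integrable hint
  have hS : Integrable (fun x : Fin N → X => ∑ i, llr ν μ₀ (x i)) (Measure.pi fun _ => ν) :=
    integrable_finsetSum _ fun i _ => hcomp i
  have hprod : ∀ x : Fin N → X,
      Real.exp (-∑ i, llr ν μ₀ (x i)) = ∏ i, Real.exp (-llr ν μ₀ (x i)) := fun x => by
    rw [← Finset.sum_neg_distrib, Real.exp_sum]
  have hE : Integrable (fun x : Fin N → X => Real.exp (-∑ i, llr ν μ₀ (x i)))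
      (Measure.pi fun _ => ν) := by
    simp_rw [hprod]
    exact Integrable.fintype_prod fun _ => hei
  have hSE : Integrable (fun x : Fin N → X =>
      ∑ i, llr ν μ₀ (x i) + Real.exp (-∑ i, llr ν μ₀ (x i))) (Measure.pi fun _ => ν) := hS.add hE
  calc ∫⁻ x, ENNReal.ofReal (∑ i, llr ν μ₀ (x i)) ∂(Measure.pi fun _ : Fin N => ν)
      ≤ ∫⁻ x, ENNReal.ofReal (∑ i, llr ν μ₀ (x i) + Real.exp (-∑ i, llr ν μ₀ (x i)))
          ∂(Measure.pi fun _ : Fin N => ν) :=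
        lintegral_mono fun x => ENNReal.ofReal_le_ofReal
          (le_add_of_nonneg_right (Real.exp_pos _).le)
    _ = ENNReal.ofReal (∫ x, (∑ i, llr ν μ₀ (x i) + Real.exp (-∑ i, llr ν μ₀ (x i)))
          ∂(Measure.pi fun _ : Fin N => ν)) := by
        rw [ofReal_integral_eq_lintegral_ofReal hSE (ae_of_all _ fun x => ?_)]
        have := Real.add_one_le_exp (-∑ i, llr ν μ₀ (x i))
        change 0 ≤ ∑ i, llr ν μ₀ (x i) + Real.exp (-∑ i, llr ν μ₀ (x i))
        linarith
    _ ≤ ENNReal.ofReal (N * (klDiv ν μ₀).toReal + 1) := by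
        refine ENNReal.ofReal_le_ofReal ?_
        rw [integral_add hS hE, integral_finsetSum _ fun i _ => hcomp i]
        simp_rw [hprod]
        rw [integral_fintype_prod_eq_pow fun x => Real.exp (-llr ν μ₀ x)]
        have h1 : ∀ i : Fin N, ∫ x : Fin N → X, llr ν μ₀ (x i) ∂(Measure.pi fun _ : Fin N => ν) =
            (klDiv ν μ₀).toReal := fun i => by
          rw [toReal_klDiv_of_measure_eq hac (by simp)]
          exact integral_comp_eval (μ := fun _ : Fin N => ν) hint.aestronglyMeasurable
        rw [Finset.sum_congr rfl fun i _ => h1 i]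
        simp only [Finset.sum_const, Finset.card_univ, Fintype.card_fin, nsmul_eq_mul]
        gcongr
        exact pow_le_one₀ (integral_nonneg fun x => (Real.exp_pos _).le) hev

/-- The change of measure estimate: on the event that the Hamiltonian and the log-likelihood are
not too large, the Gibbs weight dominates the sampling law. -/
lemma pi_le_mul_gibbsWeight {ν μ₀ : Measure X} [IsProbabilityMeasure ν]
    [IsProbabilityMeasure μ₀] (hac : ν ≪ μ₀) {m : ℕ} (hm : 1 ≤ m) {W : (Fin m → X) → EReal}
    (hWm : Measurable W) (hbot : ∀ y, W y ≠ ⊥) {C : ℝ} (hC : ∀ y, ((-C : ℝ) : EReal) ≤ W y)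
    (N : ℕ+) {b : ℝ} (hb : 0 < b) {A : Set (Fin N → X)} (hA : MeasurableSet A) (K : ℝ) :
    (Measure.pi fun _ : Fin N => ν) (A ∩ {x | ENNReal.ofReal b *
        nonnegHamiltonian (fun y => (W y + C).toENNReal) N x +
          ENNReal.ofReal (∑ i, llr ν μ₀ (x i)) < ENNReal.ofReal K}) ≤
      ENNReal.ofReal (Real.exp (K - b * (N * (C * ((N : ℕ).descFactorial m / (N : ℝ) ^ m))))) *
        gibbsWeight μ₀ W b N A := by
  set φ : (Fin m → X) → ℝ≥0∞ := fun y => (W y + C).toENNReal with hφ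
  have hφm : Measurable φ := (hWm.add_const _).ereal_toENNReal
  have hSm : Measurable fun x : Fin N → X => ∑ i, llr ν μ₀ (x i) :=
    Finset.measurable_sum _ fun i _ => (measurable_llr ν μ₀).comp (measurable_pi_apply i)
  set V : (Fin N → X) → ℝ≥0∞ := fun x => ENNReal.ofReal b * nonnegHamiltonian φ N x +
    ENNReal.ofReal (∑ i, llr ν μ₀ (x i)) with hV
  have hVm : Measurable V :=
    ((measurable_nonnegHamiltonian hφm N).const_mul _).add hSm.ennreal_ofReal
  set q : ℝ := N * (C * ((N : ℕ).descFactorial m / (N : ℝ) ^ m)) with hq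
  have hB : MeasurableSet (A ∩ {x | V x < ENNReal.ofReal K}) :=
    hA.inter (measurableSet_lt hVm measurable_const)
  calc (Measure.pi fun _ : Fin N => ν) (A ∩ {x | V x < ENNReal.ofReal K})
      ≤ ∫⁻ x in A ∩ {x | V x < ENNReal.ofReal K},
          ENNReal.ofReal (Real.exp (∑ i, llr ν μ₀ (x i))) ∂(Measure.pi fun _ : Fin N => μ₀) :=
        pi_le_lintegral_exp_llr hac N hB
    _ ≤ ∫⁻ x in A ∩ {x | V x < ENNReal.ofReal K}, ENNReal.ofReal (Real.exp (K - b * q)) *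
          EReal.exp (-((b : EReal) * hamiltonian W N x)) ∂(Measure.pi fun _ : Fin N => μ₀) := by
        refine setLIntegral_mono' hB fun x hx => ?_
        have hxK : V x < ENNReal.ofReal K := hx.2
        -- The strict bound defining the event forces the Hamiltonian to be finite there, which
        -- permits real arithmetic.
        have hbh : ENNReal.ofReal b * nonnegHamiltonian φ N x ≠ ⊤ :=
          ((le_self_add.trans_lt hxK).trans ENNReal.ofReal_lt_top).ne
        have hh : nonnegHamiltonian φ N x ≠ ⊤ := fun h => hbh (by
          rw [h, ENNReal.mul_top (by simpa using hb)])
        rw [hamiltonian_eq_nonnegHamiltonian_sub hm hbot hC N x hh, ← hφ, ← hq, ← EReal.coe_mul,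
          ← EReal.coe_neg, EReal.exp_coe, ← ENNReal.ofReal_mul (Real.exp_pos _).le,
          ← Real.exp_add]
        refine ENNReal.ofReal_le_ofReal (Real.exp_le_exp.2 ?_)
        have h1 : b * (nonnegHamiltonian φ N x).toReal + ∑ i, llr ν μ₀ (x i) ≤ K := by
          have hK : 0 < K := ENNReal.ofReal_pos.1 ((zero_le).trans_lt hxK)
          have h2 := (ENNReal.toReal_lt_toReal hxK.ne_top ENNReal.ofReal_ne_top).2 hxK
          rw [hV, ENNReal.toReal_add hbh ENNReal.ofReal_ne_top, ENNReal.toReal_mul,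
            ENNReal.toReal_ofReal hb.le, ENNReal.toReal_ofReal hK.le,
            ENNReal.toReal_ofReal'] at h2
          linarith [le_max_left (∑ i, llr ν μ₀ (x i)) 0]
        linarith
    _ = ENNReal.ofReal (Real.exp (K - b * q)) *
          gibbsWeight μ₀ W b N (A ∩ {x | V x < ENNReal.ofReal K}) := by
        rw [lintegral_const_mul' _ _ ENNReal.ofReal_ne_top, gibbsWeight, withDensity_apply _ hB]
    _ ≤ ENNReal.ofReal (Real.exp (K - b * q)) * gibbsWeight μ₀ W b N A := by
        gcongr
        exact Set.inter_subset_left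

/-- Markov's inequality for the Hamiltonian plus the positive part of the log-likelihood. -/
lemma pi_ofReal_le_hamiltonian_add_llr_le {ν μ₀ : Measure X} [IsProbabilityMeasure ν]
    [IsProbabilityMeasure μ₀] (h : klDiv ν μ₀ ≠ ⊤) {m : ℕ} (hm : 1 ≤ m) {φ : (Fin m → X) → ℝ≥0∞}
    (hφ : Measurable φ) (hφi : ∫⁻ y, φ y ∂(Measure.pi fun _ : Fin m => ν) ≠ ⊤)
    (N : ℕ+) {b : ℝ} (hb : 0 < b) {K : ℝ} (hK : 0 < K) :
    (Measure.pi fun _ : Fin N => ν) {x | ENNReal.ofReal K ≤ ENNReal.ofReal b *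
        nonnegHamiltonian φ N x + ENNReal.ofReal (∑ i, llr ν μ₀ (x i))} ≤
      ENNReal.ofReal ((b * (N * (∫⁻ y, φ y ∂(Measure.pi fun _ : Fin m => ν)).toReal) +
        (N * (klDiv ν μ₀).toReal + 1)) / K) := by
  have hSm : Measurable fun x : Fin N → X => ∑ i, llr ν μ₀ (x i) :=
    Finset.measurable_sum _ fun i _ => (measurable_llr ν μ₀).comp (measurable_pi_apply i)
  have hhm := measurable_nonnegHamiltonian hφ N
  refine (meas_ge_le_lintegral_div ((hhm.const_mul _).add hSm.ennreal_ofReal).aemeasurable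
    (by simpa using hK) ENNReal.ofReal_ne_top).trans ?_
  rw [ENNReal.ofReal_div_of_pos hK]
  gcongr
  simp only [Pi.add_apply]
  rw [lintegral_add_right _ hSm.ennreal_ofReal, lintegral_const_mul _ hhm,
    ENNReal.ofReal_add (by positivity) (by positivity), ENNReal.ofReal_mul hb.le,
    ENNReal.ofReal_mul (by positivity), ENNReal.ofReal_natCast, ENNReal.ofReal_toReal hφi]
  gcongr
  · exact lintegral_nonnegHamiltonian_le hm hφ ν N
  · exact lintegral_ofReal_sum_llr_le h N

end Lower
end MeanFieldGibbs
end

namespace MeanFieldGibbs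

/-! ### Reduction to finite entropy -/

section Truncation

open InformationTheory

variable {X : Type*} [MeasurableSpace X]

lemma klDiv_withDensity_ne_top {μ₀ : Measure X} [IsProbabilityMeasure μ₀] {ρ : X → ℝ≥0∞}
    (hρ : Measurable ρ) {M : ℝ≥0∞} (hM : M ≠ ⊤) (hρM : ∀ x, ρ x ≤ M) :
    klDiv (μ₀.withDensity ρ) μ₀ ≠ ⊤ := by
  have hfin : IsFiniteMeasure (μ₀.withDensity ρ) := by
    refine isFiniteMeasure_withDensity ((lintegral_mono hρM).trans_lt ?_).ne
    simpa using hM.lt_top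
  rw [klDiv_eq_lintegral_klFun_of_ac (withDensity_absolutelyContinuous _ _)]
  have h1 : ∫⁻ x, ENNReal.ofReal (klFun ((μ₀.withDensity ρ).rnDeriv μ₀ x).toReal) ∂μ₀ ≤
      ∫⁻ _, ENNReal.ofReal (M.toReal ^ 2 + 1) ∂μ₀ := by
    refine lintegral_mono_ae ?_
    filter_upwards [Measure.rnDeriv_withDensity μ₀ hρ] with x hx
    rw [hx]
    refine ENNReal.ofReal_le_ofReal ?_
    have h2 : (ρ x).toReal ≤ M.toReal := ENNReal.toReal_mono hM (hρM x)
    have h3 : 0 ≤ (ρ x).toReal := ENNReal.toReal_nonneg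
    have h4 : (ρ x).toReal * Real.log (ρ x).toReal ≤ (ρ x).toReal * (ρ x).toReal :=
      mul_le_mul_of_nonneg_left (Real.log_le_self h3) h3
    rw [klFun]
    nlinarith
  exact (h1.trans_lt (by simp)).ne

/-- Conditioning multiplies each coordinate's density by at most 1/ν(S). The factor tends to 1 as
ν(S) → 1, which controls the energy from above although E is only lower semicontinuous. -/
lemma lintegral_pi_cond_le {m : ℕ} (ν : Measure X) [IsProbabilityMeasure ν] {S : Set X}
    (hS : MeasurableSet S) (hS0 : ν S ≠ 0) {φ : (Fin m → X) → ℝ≥0∞} (hφ : Measurable φ) :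
    ∫⁻ y, φ y ∂(Measure.pi fun _ : Fin m => ProbabilityTheory.cond ν S) ≤
      (ν S)⁻¹ ^ m * ∫⁻ y, φ y ∂(Measure.pi fun _ : Fin m => ν) := by
  have hwd : ProbabilityTheory.cond ν S = ν.withDensity (S.indicator fun _ => (ν S)⁻¹) := by
    rw [withDensity_indicator hS, withDensity_const]
    rfl
  have hm : Measurable (S.indicator fun _ : X => (ν S)⁻¹) := measurable_const.indicator hS
  have hprob : IsProbabilityMeasure (ν.withDensity (S.indicator fun _ => (ν S)⁻¹)) := by
    rw [← hwd]
    exact ProbabilityTheory.cond_isProbabilityMeasure hS0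
  have hmp : Measurable fun x : Fin m → X => ∏ i, S.indicator (fun _ => (ν S)⁻¹) (x i) :=
    Finset.measurable_prod _ fun i _ => hm.comp (measurable_pi_apply i)
  rw [hwd, pi_withDensity ν hm, lintegral_withDensity_eq_lintegral_mul _ hmp hφ,
    ← lintegral_const_mul _ hφ]
  refine lintegral_mono fun y => ?_
  simp only [Pi.mul_apply]
  gcongr
  calc ∏ i, S.indicator (fun _ => (ν S)⁻¹) (y i) ≤ ∏ _i : Fin m, (ν S)⁻¹ :=
        Finset.prod_le_prod' fun i _ => Set.indicator_le_self' (fun _ _ => zero_le) _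
    _ = (ν S)⁻¹ ^ m := by simp

/-- Absolutely continuous measures are approximated by measures of finite entropy, with control
of the energy. -/
theorem exists_klDiv_ne_top_energy_lt [TopologicalSpace X] [CompactSpace X] [MetrizableSpace X]
    [BorelSpace X] {μ₀ : Measure X} [IsProbabilityMeasure μ₀] {m : ℕ} {W : (Fin m → X) → EReal}
    (hbot : ∀ x, W x ≠ ⊥) (hW : LowerSemicontinuous W) {ν : ProbabilityMeasure X}
    (hac : (ν : Measure X) ≪ μ₀) {G : Set (ProbabilityMeasure X)} (hG : IsOpen G) (hν : ν ∈ G)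
    {a : EReal} (ha : energy W ν < a) :
    ∃ ν' ∈ G, klDiv (ν' : Measure X) μ₀ ≠ ⊤ ∧ energy W ν' < a := by
  obtain ⟨C, hC0, hC⟩ := exists_real_le_of_lowerSemicontinuous hW hbot
  set φ : (Fin m → X) → ℝ≥0∞ := fun y => (W y + C).toENNReal with hφ
  have hφm : Measurable φ := (hW.measurable.add_const _).ereal_toENNReal
  have hen : ∀ ν : ProbabilityMeasure X, energy W ν =
      ((∫⁻ y, φ y ∂(Measure.pi fun _ : Fin m => (ν : Measure X)) : ℝ≥0∞) : EReal) - C := fun ν =>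
    eintegral_eq_lintegral_sub _ hW.measurable hC0 hC
  set ρ := (ν : Measure X).rnDeriv μ₀ with hρ
  have hρm : Measurable ρ := Measure.measurable_rnDeriv _ _
  set S : ℕ → Set X := fun k => {x | ρ x ≤ k} with hSdef
  have hS : ∀ k, MeasurableSet (S k) := fun k => measurableSet_le hρm measurable_const
  have hSmono : Monotone S := fun k l hkl x (hx : ρ x ≤ k) =>
    hx.trans (by exact_mod_cast hkl : (k : ℝ≥0∞) ≤ l)
  have hae : (⋃ k, S k : Set X) =ᵐ[(ν : Measure X)] Set.univ := by
    rw [eventuallyEq_univ, mem_ae_iff]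
    have h1 : ∀ᵐ x ∂(ν : Measure X), ρ x < ⊤ := hac.ae_le (Measure.rnDeriv_lt_top _ _)
    refine measure_mono_null (fun x hx => ?_) (ae_iff.1 h1)
    intro hlt
    obtain ⟨k, hk⟩ := ENNReal.exists_nat_gt hlt.ne
    exact hx (Set.mem_iUnion.2 ⟨k, hk.le⟩)
  have hνS : Tendsto (fun k => (ν : Measure X) (S k)) atTop (𝓝 1) := by
    have h1 := tendsto_measure_iUnion_atTop (μ := (ν : Measure X)) hSmono
    rwa [measure_congr hae, measure_univ] at h1
  have hc : Tendsto (fun k => ((ν : Measure X) (S k))⁻¹) atTop (𝓝 1) := by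
    simpa using tendsto_inv_iff.2 hνS
  have hpos : ∀ᶠ k in atTop, (ν : Measure X) (S k) ≠ 0 :=
    (hνS.eventually_const_lt zero_lt_one).mono fun k hk => hk.ne'
  -- The fallback value ν only keeps the sequence defined; ν(S_k) → 1, so it is eventually not used.
  let ν' : ℕ → ProbabilityMeasure X := fun k =>
    if h : (ν : Measure X) (S k) ≠ 0 then
      ⟨ProbabilityTheory.cond (ν : Measure X) (S k),
        ProbabilityTheory.cond_isProbabilityMeasure h⟩
    else ν
  have hν' : ∀ k, (ν : Measure X) (S k) ≠ 0 →
      (ν' k : Measure X) = ProbabilityTheory.cond (ν : Measure X) (S k) := fun k hk => by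
    have h : ν' k = ⟨ProbabilityTheory.cond (ν : Measure X) (S k),
      ProbabilityTheory.cond_isProbabilityMeasure hk⟩ := dif_pos hk
    rw [h]
    rfl
  have htend : Tendsto ν' atTop (𝓝 ν) := by
    rw [ProbabilityMeasure.tendsto_iff_forall_integral_tendsto]
    intro f
    have h1 : Tendsto (fun k => ∫ x in S k, f x ∂(ν : Measure X)) atTop
        (𝓝 (∫ x in ⋃ k, S k, f x ∂(ν : Measure X))) :=
      tendsto_setIntegral_of_monotone hS hSmono
        (BoundedContinuousFunction.integrable _ f).integrableOn
    rw [Measure.restrict_congr_set hae, Measure.restrict_univ] at h1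
    have h2 : Tendsto (fun k => (((ν : Measure X) (S k))⁻¹).toReal) atTop (𝓝 1) := by
      rw [← ENNReal.toReal_one]
      exact (ENNReal.tendsto_toReal ENNReal.one_ne_top).comp hc
    have h3 := h2.mul h1
    rw [one_mul] at h3
    refine h3.congr' ?_
    filter_upwards [hpos] with k hk
    rw [hν' k hk, ProbabilityTheory.cond, integral_smul_measure, smul_eq_mul]
  have hΦ : ∫⁻ y, φ y ∂(Measure.pi fun _ : Fin m => (ν : Measure X)) ≠ ⊤ := fun h => by
    rw [hen, h] at ha
    simp at ha
  have hlim : Tendsto (fun k => ((((ν : Measure X) (S k))⁻¹ ^ m *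
      ∫⁻ y, φ y ∂(Measure.pi fun _ : Fin m => (ν : Measure X)) : ℝ≥0∞) : EReal)) atTop
      (𝓝 ((∫⁻ y, φ y ∂(Measure.pi fun _ : Fin m => (ν : Measure X)) : ℝ≥0∞) : EReal)) := by
    have h1 := ENNReal.Tendsto.mul_const (b := ∫⁻ y, φ y ∂(Measure.pi fun _ : Fin m =>
      (ν : Measure X))) (ENNReal.Tendsto.pow (n := m) hc) (Or.inr hΦ)
    rw [one_pow, one_mul] at h1
    exact (continuous_coe_ennreal_ereal.tendsto _).comp h1
  have hlt : ((∫⁻ y, φ y ∂(Measure.pi fun _ : Fin m => (ν : Measure X)) : ℝ≥0∞) : EReal) <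
      a + C := by
    rw [hen] at ha
    exact (EReal.sub_lt_iff (Or.inl (EReal.coe_ne_bot _)) (Or.inl (EReal.coe_ne_top _))).1 ha
  obtain ⟨k, hkG, hk0, hklt⟩ := ((htend.eventually (hG.mem_nhds hν)).and
    (hpos.and (hlim.eventually_lt_const hlt))).exists
  refine ⟨ν' k, hkG, ?_, ?_⟩
  -- The conditioned measure has density at most k / ν(S_k), and a bounded density has finite
  -- entropy.
  · have hwd : (ν' k : Measure X) = μ₀.withDensity
        (((ν : Measure X) (S k))⁻¹ • (S k).indicator ρ) := by
      rw [hν' k hk0, ProbabilityTheory.cond, withDensity_smul _ (hρm.indicator (hS k)),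
        withDensity_indicator (hS k), ← restrict_withDensity (hS k),
        Measure.withDensity_rnDeriv_eq _ _ hac]
    rw [hwd]
    refine klDiv_withDensity_ne_top ((hρm.indicator (hS k)).const_smul _)
      (M := ((ν : Measure X) (S k))⁻¹ * k)
      (ENNReal.mul_ne_top (ENNReal.inv_ne_top.2 hk0) (ENNReal.natCast_ne_top k)) fun x => ?_
    rw [Pi.smul_apply, smul_eq_mul]
    gcongr
    by_cases hx : x ∈ S k
    · rw [Set.indicator_of_mem hx]
      exact hx
    · rw [Set.indicator_of_notMem hx]
      exact zero_le
  · rw [hen]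
    refine (EReal.sub_lt_iff (Or.inl (EReal.coe_ne_bot _)) (Or.inl (EReal.coe_ne_top _))).2 ?_
    refine lt_of_le_of_lt ?_ hklt
    rw [EReal.coe_ennreal_le_coe_ennreal_iff, hν' k hk0]
    exact lintegral_pi_cond_le _ (hS k) hk0 hφm

end Truncation

/-! ### Lower bound and assembly of the principle -/

section LDP

open InformationTheory

variable {X : Type*} [TopologicalSpace X] [CompactSpace X] [MetrizableSpace X]
  [MeasurableSpace X] [BorelSpace X]

/-- The lower bound for the non-normalized Gibbs measures at a measure of finite entropy. -/
theorem eventually_le_empiricalLaw_gibbsWeight {μ₀ : Measure X} [IsProbabilityMeasure μ₀]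
    {m : ℕ} (hm : 1 ≤ m) {W : (Fin m → X) → EReal} (hbot : ∀ x, W x ≠ ⊥)
    (hW : LowerSemicontinuous W) {β : ℕ+ → ℝ} (hβ : ∀ N, 0 < β N) {t : ℝ} (ht : 0 ≤ t)
    (hβt : Tendsto (fun N => 1 / β N) atTop (𝓝 t))
    (hr : Tendsto (fun N : ℕ+ => β N * N) atTop atTop)
    {G : Set (ProbabilityMeasure X)} (hG : IsOpen G) {ν : ProbabilityMeasure X} (hν : ν ∈ G)
    (hD : klDiv (ν : Measure X) μ₀ ≠ ⊤) {a : ℝ}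
    (ha : energy W ν + t * (klDiv (ν : Measure X) μ₀ : EReal) < (a : EReal)) :
    ∀ᶠ N in atTop, ENNReal.ofReal (Real.exp (-(β N * N * a))) ≤
      empiricalLaw N (gibbsWeight μ₀ W (β N) N) G := by
  obtain ⟨C, hC0, hC⟩ := exists_real_le_of_lowerSemicontinuous hW hbot
  set φ : (Fin m → X) → ℝ≥0∞ := fun y => (W y + C).toENNReal with hφ
  have hφm : Measurable φ := (hW.measurable.add_const _).ereal_toENNReal
  have hac : (ν : Measure X) ≪ μ₀ := (klDiv_ne_top_iff.1 hD).1
  rw [show energy W ν = _ from eintegral_eq_lintegral_sub _ hW.measurable hC0 hC,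
    ← EReal.coe_ennreal_toReal hD, ← EReal.coe_mul, ← hφ] at ha
  have hΦ : ∫⁻ y, φ y ∂(Measure.pi fun _ : Fin m => (ν : Measure X)) ≠ ⊤ := fun h => by
    rw [h, EReal.coe_ennreal_top, EReal.top_sub_coe, EReal.top_add_coe] at ha
    exact not_top_lt ha
  rw [← EReal.coe_ennreal_toReal hΦ, ← EReal.coe_sub, ← EReal.coe_add,
    EReal.coe_lt_coe_iff] at ha
  set Φ := (∫⁻ y, φ y ∂(Measure.pi fun _ : Fin m => (ν : Measure X))).toReal with hΦdef
  set D := (klDiv (ν : Measure X) μ₀).toReal with hDdef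
  have hΦ0 : 0 ≤ Φ := ENNReal.toReal_nonneg
  have hD0 : 0 ≤ D := ENNReal.toReal_nonneg
  have htD : 0 ≤ t * D := mul_nonneg ht hD0
  -- One ε is the slack in Markov's inequality, the other absorbs the constant probability δ/2.
  obtain ⟨ε, hε, hεa⟩ : ∃ ε : ℝ, 0 < ε ∧ Φ - C + t * D + 2 * ε < a :=
    ⟨(a - (Φ - C + t * D)) / 3, by linarith, by linarith⟩
  -- β_N N (L - ε) is exactly the moment bound, its third term being the unit lost to the positive
  -- part; β_N N L is the threshold.
  set L : ℕ+ → ℝ := fun N => Φ + 1 / β N * D + (β N * N)⁻¹ + ε with hL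
  have hLlim : Tendsto L atTop (𝓝 (Φ + t * D + 0 + ε)) :=
    (((hβt.mul_const D).const_add Φ).add (tendsto_inv_atTop_zero.comp hr)).add_const ε
  rw [add_zero] at hLlim
  have hLpos : 0 < Φ + t * D + ε := by linarith
  -- Chosen so that the Markov quotient (L - ε)/L tends to 1 - 2δ.
  set δ := ε / (2 * (Φ + t * D + ε)) with hδ
  have hδ0 : 0 < δ := by positivity
  have hδ1 : δ ≤ 1 := by
    rw [hδ, div_le_one (by positivity)]
    linarith
  have hquot : Tendsto (fun N => (L N - ε) / L N) atTop (𝓝 (1 - 2 * δ)) := by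
    have h1 := (hLlim.sub_const ε).div hLlim hLpos.ne'
    convert! h1 using 2
    rw [hδ]
    field_simp
  have hexpo : Tendsto (fun N : ℕ+ => L N - C * ((N : ℕ).descFactorial m / (N : ℝ) ^ m)) atTop
      (𝓝 (Φ + t * D + ε - C * 1)) :=
    hLlim.sub ((tendsto_descFactorial_div_pow m).const_mul C)
  have hwlln := tendsto_pi_empiricalMeasure_notMem ν hG hν
  filter_upwards [hquot.eventually_lt_const (by linarith : 1 - 2 * δ < 1 - δ),
    hexpo.eventually_lt_const (by linarith : Φ + t * D + ε - C * 1 < a - ε),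
    hwlln.eventually_lt_const (ENNReal.ofReal_pos.2 (half_pos hδ0)),
    eventually_const_mul_exp_le hr (by linarith : a - ε < a) (2 / δ)] with N h1 h2 h3 h4
  have hN : (0 : ℝ) < N := by exact_mod_cast N.pos
  have hb := hβ N
  have hLN : 0 < L N := by simp only [hL]; positivity
  set K := β N * N * L N with hK
  have hK0 : 0 < K := by positivity
  set A : Set (Fin N → X) := empiricalMeasure N ⁻¹' G with hA
  have hAm : MeasurableSet A := (hG.preimage (continuous_empiricalMeasure N)).measurableSet
  have hcore := pi_le_mul_gibbsWeight hac hm hW.measurable hbot hC N hb hAm K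
  have hmarkov := pi_ofReal_le_hamiltonian_add_llr_le hD hm hφm hΦ N hb hK0
  rw [← hφ] at hcore
  set V : (Fin N → X) → ℝ≥0∞ := fun x => ENNReal.ofReal (β N) * nonnegHamiltonian φ N x +
    ENNReal.ofReal (∑ i, llr (ν : Measure X) μ₀ (x i)) with hV
  have hv : (β N * (N * Φ) + (N * D + 1)) / K = (L N - ε) / L N := by
    have h5 : β N * (N * Φ) + (N * D + 1) = β N * N * (L N - ε) := by
      simp only [hL]
      field_simp
      ring
    rw [h5, hK, mul_div_mul_left _ _ (mul_pos hb hN).ne']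
  rw [← hΦdef, ← hDdef, hv] at hmarkov
  -- The law of large numbers fails with probability at most δ/2 and the moment bound with
  -- probability at most 1 - δ, leaving δ/2.
  have hprob : ENNReal.ofReal (δ / 2) ≤ (Measure.pi fun _ : Fin N => (ν : Measure X))
      (A ∩ {x | V x < ENNReal.ofReal K}) := by
    have hcover : (Set.univ : Set (Fin N → X)) ⊆ (A ∩ {x | V x < ENNReal.ofReal K}) ∪
        ({x | empiricalMeasure N x ∉ G} ∪ {x | ENNReal.ofReal K ≤ V x}) := fun x _ => by
      by_cases hx : empiricalMeasure N x ∈ G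
      · rcases lt_or_ge (V x) (ENNReal.ofReal K) with h | h
        · exact Or.inl ⟨hx, h⟩
        · exact Or.inr (Or.inr h)
      · exact Or.inr (Or.inl hx)
    have h5 := (measure_mono hcover).trans ((measure_union_le _ _).trans
      (add_le_add le_rfl (measure_union_le _ _)) :
        (Measure.pi fun _ : Fin N => (ν : Measure X)) _ ≤ _)
    rw [measure_univ] at h5
    have h6 := h5.trans (add_le_add le_rfl (add_le_add h3.le
      (hmarkov.trans (ENNReal.ofReal_le_ofReal h1.le))))
    rw [← ENNReal.ofReal_add (by linarith) (by linarith)] at h6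
    refine (ENNReal.add_le_add_iff_right
      (ENNReal.ofReal_ne_top (r := δ / 2 + (1 - δ)))).1 (le_trans (le_of_eq ?_) h6)
    rw [← ENNReal.ofReal_add (by linarith) (by linarith), ← ENNReal.ofReal_one]
    congr 1
    ring
  rw [empiricalLaw_apply N _ (MeasurableSpace.measurableSet_generateFrom hG), ← hA]
  have h7 : K - β N * (N * (C * ((N : ℕ).descFactorial m / (N : ℝ) ^ m))) ≤
      β N * N * (a - ε) := by
    have := mul_le_mul_of_nonneg_left h2.le (mul_pos hb hN).le
    rw [hK]
    linarith
  have h8 : Real.exp (-(β N * N * a)) ≤ Real.exp (-(β N * N * (a - ε))) * (δ / 2) := by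
    have h9 : Real.exp (-(β N * N * a)) =
        2 / δ * Real.exp (-(β N * N * a)) * (δ / 2) := by
      field_simp
    rw [h9]
    gcongr
  calc ENNReal.ofReal (Real.exp (-(β N * N * a)))
      ≤ ENNReal.ofReal (Real.exp (-(β N * N * (a - ε)))) * ENNReal.ofReal (δ / 2) := by
        rw [← ENNReal.ofReal_mul (Real.exp_pos _).le]
        exact ENNReal.ofReal_le_ofReal h8
    _ ≤ ENNReal.ofReal (Real.exp (-(β N * N * (a - ε)))) *
          (ENNReal.ofReal (Real.exp (β N * N * (a - ε))) * gibbsWeight μ₀ W (β N) N A) := by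
        gcongr
        refine (hprob.trans hcore).trans ?_
        gcongr
    _ = gibbsWeight μ₀ W (β N) N A := by
        rw [← mul_assoc, ← ENNReal.ofReal_mul (Real.exp_pos _).le, ← Real.exp_add,
          neg_add_cancel, Real.exp_zero, ENNReal.ofReal_one, one_mul]

/-- The LDP for the non-normalized Gibbs measures when the temperatures converge to `t ≥ 0`. -/
theorem satisfiesLDP_gibbsWeight {μ₀ : Measure X} [IsProbabilityMeasure μ₀]
    {m : ℕ} (hm : 1 ≤ m) {W : (Fin m → X) → EReal} (hbot : ∀ x, W x ≠ ⊥)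
    (hW : LowerSemicontinuous W) {β : ℕ+ → ℝ} (hβ : ∀ N, 0 < β N) {t : ℝ} (ht : 0 ≤ t)
    (hβt : Tendsto (fun N => 1 / β N) atTop (𝓝 t))
    (hr : Tendsto (fun N : ℕ+ => β N * N) atTop atTop)
    (happ : t = 0 → ApproximationProperty μ₀ (energy W)) :
    SatisfiesLDP (fun N => empiricalLaw N (gibbsWeight μ₀ W (β N) N)) (fun N => β N * N)
      (fun μ => energy W μ + t * (klDiv (μ : Measure X) μ₀ : EReal)) := by
  obtain ⟨C, -, hC⟩ := exists_real_le_of_lowerSemicontinuous hW hbot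
  have hE : ∀ μ, energy W μ ≠ ⊥ := fun μ =>
    ((EReal.bot_lt_coe _).trans_le (neg_le_energy hC μ)).ne'
  have htD : ∀ μ : ProbabilityMeasure X, 0 ≤ (t : EReal) * (klDiv (μ : Measure X) μ₀ : EReal) :=
    fun μ => mul_nonneg (by exact_mod_cast ht) (EReal.coe_ennreal_nonneg _)
  refine satisfiesLDP_of_local (fun N => mul_pos (hβ N) (by exact_mod_cast N.pos)) hr
    (fun μ => ?_) (fun μ c hc => ?_) (fun μ a ha => ?_) (fun G hG μ hμ a ha => ?_)
  · rw [Ne, EReal.add_eq_bot_iff, not_or]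
    exact ⟨hE μ, (EReal.bot_lt_zero.trans_le (htD μ)).ne'⟩
  · obtain ⟨a, hca, ha⟩ := EReal.lt_iff_exists_real_btwn.1 hc
    obtain ⟨U, hU, hμU, hlt, -⟩ :=
      exists_nhds_empiricalLaw_gibbsWeight_le μ₀ hm hbot hW hβ ht hβt μ ha
    exact mem_of_superset (hU.mem_nhds hμU) fun ν hν => hca.trans (hlt ν hν)
  · obtain ⟨U, hU, hμU, -, hev⟩ :=
      exists_nhds_empiricalLaw_gibbsWeight_le μ₀ hm hbot hW hβ ht hβt μ ha
    exact ⟨U, hU.mem_nhds hμU, hev⟩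
  · obtain ⟨ν, hνG, hνD, hν⟩ : ∃ ν ∈ G, klDiv (ν : Measure X) μ₀ ≠ ⊤ ∧
        energy W ν + t * (klDiv (ν : Measure X) μ₀ : EReal) < a := by
      -- At t = 0 the point μ may have infinite entropy and must be replaced by a nearby measure;
      -- for t > 0 the assumed upper bound already makes its entropy finite.
      rcases ht.eq_or_lt with h0 | h0
      · subst h0
        simp only [EReal.coe_zero, zero_mul, add_zero] at ha ⊢
        obtain ⟨ν, hac, hlim, hElim⟩ := happ rfl μ (ha.trans (EReal.coe_lt_top a))
        obtain ⟨j, hjG, hja⟩ := ((hlim.eventually (hG.mem_nhds hμ)).and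
          (hElim.eventually_lt_const ha)).exists
        exact exists_klDiv_ne_top_energy_lt hbot hW (hac j) hG hjG hja
      · refine ⟨μ, hμ, fun h => ?_, ha⟩
        simp only [h, EReal.coe_ennreal_top, EReal.coe_mul_top_of_pos h0,
          EReal.add_top_of_ne_bot (hE μ)] at ha
        exact not_top_lt ha
    exact eventually_le_empiricalLaw_gibbsWeight hm hbot hW hβ ht hβt hr hG hνG hνD hν

/-- The LDP for the Gibbs measures when the temperatures converge to `t ≥ 0`. -/
theorem satisfiesLDP_gibbsMeasure {μ₀ : Measure X} [IsProbabilityMeasure μ₀]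
    {m : ℕ} (hm : 1 ≤ m) {W : (Fin m → X) → EReal} (hbot : ∀ x, W x ≠ ⊥)
    (hW : LowerSemicontinuous W) {β : ℕ+ → ℝ} (hβ : ∀ N, 0 < β N) {t : ℝ} (ht : 0 ≤ t)
    (hβt : Tendsto (fun N => 1 / β N) atTop (𝓝 t))
    (hr : Tendsto (fun N : ℕ+ => β N * N) atTop atTop)
    (happ : t = 0 → ApproximationProperty μ₀ (energy W))
    (hfin : ∃ μ : ProbabilityMeasure X,
      energy W μ + t * (klDiv (μ : Measure X) μ₀ : EReal) < ⊤) :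
    SatisfiesLDP (fun N => empiricalLaw N (gibbsMeasure μ₀ W (β N) N)) (fun N => β N * N)
      (fun μ => energy W μ + t * (klDiv (μ : Measure X) μ₀ : EReal) -
        ⨅ ν : ProbabilityMeasure X, (energy W ν + t * (klDiv (ν : Measure X) μ₀ : EReal))) := by
  have h := satisfiesLDP_gibbsWeight hm hbot hW hβ ht hβt hr happ
  obtain ⟨C, -, hC⟩ := exists_real_le_of_lowerSemicontinuous hW hbot
  have hlaw : ∀ N : ℕ+, empiricalLaw N (gibbsMeasure μ₀ W (β N) N) =
      (partitionFunction μ₀ W (β N) N)⁻¹ • empiricalLaw N (gibbsWeight μ₀ W (β N) N) := fun N => by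
    simp only [empiricalLaw, gibbsMeasure]
    exact Measure.map_smul _ _ _
  simp_rw [hlaw]
  refine h.normalize (fun N => ?_) (fun N => mul_pos (hβ N) (by exact_mod_cast N.pos)) ?_ ?_
  · rw [empiricalLaw_apply N _ (@MeasurableSet.univ _ (borel _)), Set.preimage_univ, gibbsWeight,
      withDensity_apply _ MeasurableSet.univ, Measure.restrict_univ, partitionFunction]
  · refine ((EReal.bot_lt_coe (-C)).trans_le (le_iInf fun μ => ?_)).ne'
    exact (neg_le_energy hC μ).trans (le_add_of_nonneg_right
      (mul_nonneg (by exact_mod_cast ht) (EReal.coe_ennreal_nonneg _)))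
  · obtain ⟨μ, hμ⟩ := hfin
    exact ((iInf_le _ μ).trans_lt hμ).ne

end LDP

end MeanFieldGibbs

/-! ### The two temperature regimes -/

theorem corollary1p2 {X : Type*} [TopologicalSpace X] [CompactSpace X] [MetrizableSpace X]
    [MeasurableSpace X] [BorelSpace X] (μ₀ : Measure X) [IsProbabilityMeasure μ₀]
    (m : ℕ) (hm : 1 ≤ m) (W : (Fin m → X) → EReal)
    (hW_ne_bot : ∀ x, W x ≠ ⊥)
    (hW_symm : ∀ (σ : Equiv.Perm (Fin m)) (x : Fin m → X), W (fun k => x (σ k)) = W x)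
    (hW_lsc : LowerSemicontinuous W)
    (β : ℕ+ → ℝ) (hβ : ∀ N, 0 < β N)
    (hZ : ∀ N : ℕ+, MeanFieldGibbs.partitionFunction μ₀ W (β N) N ≠ 0 ∧
      MeanFieldGibbs.partitionFunction μ₀ W (β N) N ≠ ⊤) :
    -- positive limiting temperature
    (∀ b : ℝ, 0 < b → Tendsto β atTop (𝓝 b) →
      MeanFieldGibbs.SatisfiesLDP
        (fun N => MeanFieldGibbs.empiricalLaw N (MeanFieldGibbs.gibbsWeight μ₀ W (β N) N))
        (fun N => β N * N) (MeanFieldGibbs.freeEnergy μ₀ W b) ∧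
      ((∃ μ, MeanFieldGibbs.freeEnergy μ₀ W b μ < ⊤) →
        MeanFieldGibbs.SatisfiesLDP
          (fun N => MeanFieldGibbs.empiricalLaw N (MeanFieldGibbs.gibbsMeasure μ₀ W (β N) N))
          (fun N => β N * N)
          (fun μ => MeanFieldGibbs.freeEnergy μ₀ W b μ -
            ⨅ ν, MeanFieldGibbs.freeEnergy μ₀ W b ν))) ∧
    -- zero limiting temperature
    (Tendsto β atTop atTop →
      MeanFieldGibbs.ApproximationProperty μ₀ (MeanFieldGibbs.energy W) →
      MeanFieldGibbs.SatisfiesLDP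
        (fun N => MeanFieldGibbs.empiricalLaw N (MeanFieldGibbs.gibbsWeight μ₀ W (β N) N))
        (fun N => β N * N) (MeanFieldGibbs.energy W) ∧
      ((∃ μ, MeanFieldGibbs.energy W μ < ⊤) →
        MeanFieldGibbs.SatisfiesLDP
          (fun N => MeanFieldGibbs.empiricalLaw N (MeanFieldGibbs.gibbsMeasure μ₀ W (β N) N))
          (fun N => β N * N)
          (fun μ => MeanFieldGibbs.energy W μ - ⨅ ν, MeanFieldGibbs.energy W ν))) := by
  have hN : Tendsto (fun N : ℕ+ => ((N : ℕ) : ℝ)) atTop atTop :=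
    tendsto_natCast_atTop_atTop.comp tendsto_PNat_val_atTop_atTop
  refine ⟨fun b hb hβb => ?_, fun hβ' happ => ?_⟩
  · have ht : (0 : ℝ) ≤ 1 / b := (one_div_pos.2 hb).le
    have hβt : Tendsto (fun N => 1 / β N) atTop (𝓝 (1 / b)) :=
      tendsto_const_nhds.div hβb hb.ne'
    have hr : Tendsto (fun N : ℕ+ => β N * N) atTop atTop := hβb.pos_mul_atTop hb hN
    -- At positive temperature the approximation property is required only vacuously.
    have happ : 1 / b = 0 → MeanFieldGibbs.ApproximationProperty μ₀ (MeanFieldGibbs.energy W) :=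
      fun h => absurd h (one_div_pos.2 hb).ne'
    exact ⟨MeanFieldGibbs.satisfiesLDP_gibbsWeight hm hW_ne_bot hW_lsc hβ ht hβt hr happ,
      fun hfin => MeanFieldGibbs.satisfiesLDP_gibbsMeasure hm hW_ne_bot hW_lsc hβ ht hβt hr happ
        hfin⟩
  · have hβt : Tendsto (fun N => 1 / β N) atTop (𝓝 0) := by
      simpa [Function.comp_def] using tendsto_inv_atTop_zero.comp hβ'
    have hr : Tendsto (fun N : ℕ+ => β N * N) atTop atTop := hβ'.atTop_mul_atTop₀ hN
    have h1 := MeanFieldGibbs.satisfiesLDP_gibbsWeight hm hW_ne_bot hW_lsc hβ le_rfl hβt hr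
      fun _ => happ
    have h2 := MeanFieldGibbs.satisfiesLDP_gibbsMeasure hm hW_ne_bot hW_lsc hβ le_rfl hβt hr
      fun _ => happ
    -- In `EReal`, 0 · ⊤ = 0, so the entropy term disappears even where the entropy is infinite.
    simp only [EReal.coe_zero, zero_mul, add_zero] at h1 h2
    exact ⟨h1, h2⟩
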